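/- Let $Z_i$ and $X_i$ denote the Pauli operators on qubit $i$ of a line of $n$ qubits, and let $\mathcal S=\{Z_i : 1\le i\le n\}\cup\{X_iX_{i+1} : 1\le i<n\}$. An elementary matchgate is a unitary $e^{i\theta H}$ with $H\in\mathcal S$ and $\theta\in\mathbb R$. The matchgate group $\mathrm{Spin}(2n)$ is the compact group of unitaries generated by the elementary matchgates, and $\mu_{\mathrm{Spin}(2n)}$ is its Haar probability measure. For an ensemble $\mathcal E$ (a Borel probability measure on the unitary group of $(\mathbb C^2)^{\otimes n}$) let $\phi^{(2)}_{\mathcal E}(\rho)=\mathbb E_{U\sim\mathcal E}\big[U^{\otimes 2}\rho\,(U^\dagger)^{\otimes 2}\big]$. A matchgate 2-design is an ensemble $\mathcal F$ with $\phi^{(2)}_{\mathcal F}=\phi^{(2)}_{\mu_{\mathrm{Spin}(2n)}}$; the Haar measure itself is one. The diamond norm of a linear map $\Phi$ is $\|\Phi\|_\diamond=\sup_\rho\|(\Phi\otimes\mathcal I)\rho\|_1$, over all states $\rho$ of the system together with an ancilla of arbitrary finite dimension. **Corollary.** Let $\mathcal E$ be any ensemble of $n$-qubit circuits each of which is a product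 of fewer than $n^2/2$ elementary matchgates (the number of gates may vary from circuit to circuit), and let $\mathcal F$ be any matchgate 2-design on $n$ qubits. Then $$\big\|\phi^{(2)}_{\mathcal E}-\phi^{(2)}_{\mathcal F}\big\|_\diamond\ \ge\ 1 .$$ Moreover, $\mathcal E$ can be efficiently distinguished from $\mathcal F$: there are a polynomial $p$ and, for every $n$, an experiment depending only on $n$ that uses $U^{\otimes 2}$ once, between a preparation circuit that acts on the all-zero state of the $2n$ system qubits and some ancilla qubits, and a final circuit followed by the computational-basis measurement of one qubit, in which the number of ancilla qubits plus the number of gates (from the set NOT, Hadamard, $T$, CNOT, Toffoli) of the two circuits is at most $p(n)$, such that, for all $\mathcal E$ and $\mathcal F$ as above, if $U$ is drawn with probability $1/2$ each from $\mathcal E$ or from $\mathcal F$, the outcome identifies the ensemble correctly with probability at least $3/4$, and with probability greater than $3/4$ if $n$ is even. -/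

import Mathlib

open MeasureTheory
open scoped ENNReal Kronecker Matrix ComplexOrder

noncomputable section

namespace Matchgate

/-! ### Qubits, Pauli strings, and the matchgate group -/

/-- Labels of the computational basis of `n` qubits. -/
abbrev Bits (n : ℕ) : Type := Fin n → Bool

/-- The group of unitaries on the Hilbert space of `n` qubits, with its usual topology. -/
abbrev Uni (n : ℕ) : Type := Matrix.unitaryGroup (Bits n) ℂ

instance (n : ℕ) : MeasurableSpace (Uni n) := borel _

instance (n : ℕ) : BorelSpace (Uni n) := ⟨rfl⟩

theorem isCompact_unitary (n : ℕ) :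
    IsCompact (Matrix.unitaryGroup (Bits n) ℂ : Set (Matrix (Bits n) (Bits n) ℂ)) := by
  have hK : IsCompact (Set.pi Set.univ fun _ : Bits n => Set.pi Set.univ fun _ : Bits n =>
      Metric.closedBall (0 : ℂ) 1) :=
    isCompact_univ_pi fun _ => isCompact_univ_pi fun _ => isCompact_closedBall _ _
  refine IsCompact.of_isClosed_subset hK (isClosed_unitary (R := Matrix (Bits n) (Bits n) ℂ)) ?_
  intro U hU i _ j _
  simpa using entry_norm_bound_of_unitary hU i j

instance (n : ℕ) : CompactSpace (Uni n) := isCompact_iff_compactSpace.mp (isCompact_unitary n)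

/-- The Pauli operator `Z` on qubit `i`. -/
def pauliZ {n : ℕ} (i : Fin n) : Matrix (Bits n) (Bits n) ℂ :=
  Matrix.diagonal fun x => if x i then -1 else 1

/-- The Pauli operator `X` on qubit `i`. -/
def pauliX {n : ℕ} (i : Fin n) : Matrix (Bits n) (Bits n) ℂ :=
  Matrix.of fun x y => if x = Function.update y i (!(y i)) then 1 else 0

/-- The standard generators of matchgate circuits: single-qubit `Z_i` and nearest-neighbour
`X_i X_{i+1}` on an open line of qubits. -/
def generators (n : ℕ) : Set (Matrix (Bits n) (Bits n) ℂ) :=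
  {H | (∃ i : Fin n, H = pauliZ i) ∨
    ∃ i j : Fin n, (j : ℕ) = (i : ℕ) + 1 ∧ H = pauliX i * pauliX j}

/-- The elementary matchgates: the unitaries `exp (i θ H)` with `θ` real and `H` a generator. -/
def gates (n : ℕ) : Set (Uni n) :=
  {U | ∃ H ∈ generators n, ∃ θ : ℝ,
    (U : Matrix (Bits n) (Bits n) ℂ) = NormedSpace.exp ((Complex.I * (θ : ℂ)) • H)}

/-- The unitaries implemented by a circuit of elementary matchgates which has fewer than
`n ^ 2 / 2` gates. -/
def shortCircuits (n : ℕ) : Set (Uni n) :=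
  {U | ∃ l : List (Uni n), (∀ g ∈ l, g ∈ gates n) ∧ (l.length : ℝ) < (n : ℝ) ^ 2 / 2 ∧ U = l.prod}

/-- The `n`-qubit matchgate group `Spin(2n)`: the compact group of unitaries generated by the
elementary matchgates. -/
def group (n : ℕ) : Subgroup (Uni n) := (Subgroup.closure (gates n)).topologicalClosure

instance (n : ℕ) : CompactSpace (group n) :=
  isCompact_iff_compactSpace.mp (Subgroup.isClosed_topologicalClosure _).isCompact

/-- The Haar probability measure of the matchgate group, as an ensemble of unitaries. -/
def haar (n : ℕ) : Measure (Uni n) :=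
  (Measure.haarMeasure (⊤ : TopologicalSpace.PositiveCompacts (group n))).map Subtype.val

instance (n : ℕ) : IsProbabilityMeasure (haar n) := by
  have : IsProbabilityMeasure
      (Measure.haarMeasure (⊤ : TopologicalSpace.PositiveCompacts (group n))) :=
    ⟨Measure.haarMeasure_self (K₀ := (⊤ : TopologicalSpace.PositiveCompacts (group n)))⟩
  exact Measure.isProbabilityMeasure_map measurable_subtype_coe.aemeasurable

/-! ### Moment channels and the diamond norm -/

/-- `U ⊗ U` acting by conjugation on an operator on two copies of the system. -/
def twirl {n : ℕ} (ρ : Matrix (Bits n × Bits n) (Bits n × Bits n) ℂ) (U : Uni n) :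
    Matrix (Bits n × Bits n) (Bits n × Bits n) ℂ :=
  ((U : Matrix (Bits n) (Bits n) ℂ) ⊗ₖ (U : Matrix (Bits n) (Bits n) ℂ)) * ρ *
    ((U : Matrix (Bits n) (Bits n) ℂ) ⊗ₖ (U : Matrix (Bits n) (Bits n) ℂ))ᴴ

theorem integrable_twirl {n : ℕ} (μ : Measure (Uni n)) [IsProbabilityMeasure μ]
    (ρ : Matrix (Bits n × Bits n) (Bits n × Bits n) ℂ) (p q : Bits n × Bits n) :
    Integrable (fun U => twirl ρ U p q) μ := by
  have hc : Continuous fun U : Uni n => twirl ρ U p q := by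
    have he : ∀ i j : Bits n, Continuous fun U : Uni n => (U : Matrix (Bits n) (Bits n) ℂ) i j :=
      fun i j => continuous_subtype_val.matrix_elem i j
    simp only [twirl, Matrix.mul_apply, Matrix.kroneckerMap_apply, Matrix.conjTranspose_apply]
    exact continuous_finsetSum _ fun j _ => (continuous_finsetSum _ fun k _ =>
      ((he _ _).mul (he _ _)).mul continuous_const).mul ((he _ _).mul (he _ _)).star
  exact hc.integrable_of_hasCompactSupport (HasCompactSupport.of_compactSpace _)

/-- The second moment channel `ρ ↦ E_U [U^{⊗2} ρ (U^†)^{⊗2}]` of an ensemble of unitaries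
(the expectation is taken entrywise). -/
def moment {n : ℕ} (μ : Measure (Uni n)) [IsProbabilityMeasure μ] :
    Matrix (Bits n × Bits n) (Bits n × Bits n) ℂ →ₗ[ℂ]
      Matrix (Bits n × Bits n) (Bits n × Bits n) ℂ where
  toFun ρ := Matrix.of fun p q => ∫ U, twirl ρ U p q ∂μ
  map_add' ρ σ := by
    ext p q
    simp only [Matrix.of_apply, Matrix.add_apply]
    rw [← integral_add (integrable_twirl μ ρ p q) (integrable_twirl μ σ p q)]
    simp [twirl, Matrix.mul_add, Matrix.add_mul]
  map_smul' c ρ := by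
    ext p q
    simp only [Matrix.of_apply, Matrix.smul_apply, RingHom.id_apply, smul_eq_mul]
    rw [← integral_const_mul]
    simp [twirl]

/-- A (exact) matchgate 2-design: an ensemble of unitaries with the same second moment channel as
the Haar measure of the matchgate group. -/
def IsTwoDesign {n : ℕ} (ν : Measure (Uni n)) [IsProbabilityMeasure ν] : Prop :=
  moment ν = moment (haar n)

/-- The extension `Φ ⊗ id` of a linear map on operators to a system with an ancilla: `Φ` acts on
every block of the operator. -/
def extend {A : Type*} (K : Type*) (Φ : Matrix A A ℂ →ₗ[ℂ] Matrix A A ℂ)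
    (ρ : Matrix (A × K) (A × K) ℂ) : Matrix (A × K) (A × K) ℂ :=
  Matrix.of fun p q => Φ (Matrix.of fun a b => ρ (a, p.2) (b, q.2)) p.1 q.1

/-- Density matrices. -/
def IsState {A : Type*} [Fintype A] (ρ : Matrix A A ℂ) : Prop :=
  ρ.PosSemidef ∧ ρ.trace = 1

/-- The trace norm: the sum of the singular values, i.e. of the square roots of the eigenvalues of
`M^† M`. -/
def traceNorm {A : Type*} [Fintype A] [DecidableEq A] (M : Matrix A A ℂ) : ℝ :=
  ∑ i, √((Matrix.isHermitian_conjTranspose_mul_self M).eigenvalues i)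

/-- The diamond norm: the supremum of `‖(Φ ⊗ id) ρ‖₁` over all states `ρ` of the system together
with an ancilla of any finite dimension. -/
def diamondNorm {A : Type*} [Fintype A] [DecidableEq A] (Φ : Matrix A A ℂ →ₗ[ℂ] Matrix A A ℂ) :
    ℝ≥0∞ :=
  ⨆ (m : ℕ) (ρ : Matrix (A × Fin m) (A × Fin m) ℂ) (_ : IsState ρ),
    ENNReal.ofReal (traceNorm (extend (Fin m) Φ ρ))

/-- The probability of guessing correctly from which of two equally likely ensembles `μ`, `ν` the
unitary was drawn, when `U^{⊗2}` is applied to the system part of `ρ` and the two-outcome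
measurement `{P, 1 - P}` is made; the outcome `P` stands for the guess `μ`. -/
def successProb {n : ℕ} {K : Type*} [Fintype K] [DecidableEq K] (μ ν : Measure (Uni n))
    [IsProbabilityMeasure μ] [IsProbabilityMeasure ν]
    (ρ P : Matrix ((Bits n × Bits n) × K) ((Bits n × Bits n) × K) ℂ) : ℝ :=
  1 / 2 * (extend K (moment μ) ρ * P).trace.re + 1 / 2 * (extend K (moment ν) ρ * (1 - P)).trace.re

/-! ### Quantum circuits for the state preparation and the measurement -/

/-- Gates of a fixed finite universal gate set, acting on qubits labelled by `W`. -/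
inductive QGate (W : Type) : Type
  | not (t : W) : QGate W
  | hadamard (t : W) : QGate W
  | phaseT (t : W) : QGate W
  | cnot (c t : W) (h : c ≠ t) : QGate W
  | toffoli (c d t : W) (hcd : c ≠ d) (hct : c ≠ t) (hdt : d ≠ t) : QGate W

/-- The unitary matrix of a gate. -/
def QGate.matrix {W : Type} [Fintype W] [DecidableEq W] :
    QGate W → Matrix (W → Bool) (W → Bool) ℂ
  | .not t => Matrix.of fun x y => if x = Function.update y t (!(y t)) then 1 else 0
  | .hadamard t => Matrix.of fun x y =>
      if ∀ w, w ≠ t → x w = y w then (if x t && y t then -1 else 1) / (√2 : ℂ) else 0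
  | .phaseT t => Matrix.diagonal fun x =>
      if x t then Complex.exp (Complex.I * (Real.pi / 4 : ℝ)) else 1
  | .cnot c t _ => Matrix.of fun x y =>
      if x = Function.update y t (xor (y t) (y c)) then 1 else 0
  | .toffoli c d t _ _ _ => Matrix.of fun x y =>
      if x = Function.update y t (xor (y t) (y c && y d)) then 1 else 0

/-- The unitary matrix of a circuit, a list of gates of which the first one acts first. -/
def circuitMatrix {W : Type} [Fintype W] [DecidableEq W] :
    List (QGate W) → Matrix (W → Bool) (W → Bool) ℂ
  | [] => 1
  | g :: gs => circuitMatrix gs * g.matrix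

/-- The qubits of an experiment: two copies of the `n`-qubit system, and `a` ancilla qubits. -/
abbrev Wire (n a : ℕ) : Type := (Fin n ⊕ Fin n) ⊕ Fin a

/-- The basis state of all qubits given by basis states of the two copies and of the ancilla. -/
def join {n a : ℕ} (p : (Bits n × Bits n) × Bits a) : Wire n a → Bool :=
  Sum.elim (Sum.elim p.1.1 p.1.2) p.2

/-- An experiment with a single use of `U^{⊗2}`: a circuit that prepares the input from the all-zero
state, a circuit that is run afterwards, and the qubit that is finally measured in the computational
basis. -/
structure Experiment (n a : ℕ) where
  /-- the preparation circuit -/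
  prep : List (QGate (Wire n a))
  /-- the circuit run before the final measurement -/
  post : List (QGate (Wire n a))
  /-- the measured qubit -/
  out : Wire n a

/-- The cost of an experiment: the number of its gates and ancilla qubits. -/
def Experiment.size {n a : ℕ} (E : Experiment n a) : ℕ := E.prep.length + E.post.length + a

/-- The input state of an experiment. -/
def Experiment.state {n a : ℕ} (E : Experiment n a) :
    Matrix ((Bits n × Bits n) × Bits a) ((Bits n × Bits n) × Bits a) ℂ :=
  (circuitMatrix E.prep * Matrix.single (fun _ => false) (fun _ => false) 1 *
    (circuitMatrix E.prep)ᴴ).submatrix join join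

/-- The measurement operator of the outcome `1` of an experiment. -/
def Experiment.effect {n a : ℕ} (E : Experiment n a) :
    Matrix ((Bits n × Bits n) × Bits a) ((Bits n × Bits n) × Bits a) ℂ :=
  ((circuitMatrix E.post)ᴴ * Matrix.diagonal (fun x : Wire n a → Bool => if x E.out then 1 else 0) *
    circuitMatrix E.post).submatrix join join

end Matchgate

end

open MeasureTheory Matchgate

namespace Matchgate

/-! ### Bell states and their labels -/

/-! A Bell state of the two copies is a Pauli string `B` read as a vector, and `U ⊗ U` sends `B` to
`U B Uᵀ`. The generators `H` are symmetric, so the gate `exp (iθH)` sends `B` to `exp (iθH) B exp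
(iθH)`. This is `B` if `H` anticommutes with `B`, and `cos 2θ B + i sin 2θ H B` if they commute.
Pauli strings are labelled by subsets of a line of `2n` sites: the Majorana support, with every
second site complemented (up to a global complement). Each generator then belongs to an edge of this
line; it commutes with `B` exactly if one end of the edge is occupied, and `H B` is, up to a phase,
the Bell state with the two ends exchanged (`ActsAsSwap`, `rotation_conj_bell`). So matchgates are
hopping particles: their number is conserved, and one gate raises the sum of the positions, the
weight, by at most 1.

Let the first `n` sites be occupied initially. The weight is `n(n-1)/2`, and the midpoint between
this and the weight of the last `n` sites is `n(2n-1)/2`, which is `n²/2` higher. With fewer than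
`n²/2` gates the weight stays below the midpoint with certainty (`lightProb_of_mem_shortCircuits`).
Under the Haar measure, invariance under the gates with `θ = π/4`, which exchange two neighbours
outright, makes the occupied set uniform among the `n`-subsets. Reflecting the line shows that the
weight is below the midpoint with probability at most `1/2`, and less than `1/2` if some `n`-subset
lies exactly at the midpoint, as happens for even `n` (`sum_light_le_half`,
`integral_lightProb_haar`).

The projection `P` to the light Bell states therefore has expectation 1 for short circuits and `q ≤
1/2` for a 2-design. Testing the difference of the channels against the unitary `2P - 1` bounds the
diamond norm; measuring `P` succeeds with probability `1 - q/2`. The measurement is efficient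
because the Bell basis change is a layer of CNOT and of Hadamard gates, after which `P` only
compares a weight with a threshold, a classical computation done with a reversible counter
(`exists_classical_circuit`). -/

/-- The sites of the line of Majorana modes: two for every qubit. -/
abbrev Site (n : ℕ) : Type := Fin n × Bool

/-- The position of a site on the line. -/
def Site.pos {n : ℕ} (s : Site n) : ℕ := 2 * (s.1 : ℕ) + s.2.toNat

/-- The parity of the first `k` bits. -/
def prefixParity {n : ℕ} (x : Bits n) : ℕ → Bool
  | 0 => false
  | k + 1 => xor (prefixParity x k) (if h : k < n then x ⟨k, h⟩ else false)

/-- The set of Majorana modes of the Bell state with the given label, as an indicator function. -/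
def modes {n : ℕ} (l : Bits n × Bits n) (s : Site n) : Bool :=
  if s.2 then !(xor (l.2 s.1) (prefixParity l.1 (s.1 + 1))) else xor (l.2 s.1) (prefixParity l.1 s.1)

theorem prefixParity_succ {n : ℕ} (x : Bits n) (i : Fin n) :
    prefixParity x (i + 1) = xor (prefixParity x i) (x i) := by
  simp [prefixParity]

theorem modes_false {n : ℕ} (l : Bits n × Bits n) (i : Fin n) :
    modes l (i, false) = xor (l.2 i) (prefixParity l.1 i) := by
  simp [modes]

theorem modes_true {n : ℕ} (l : Bits n × Bits n) (i : Fin n) :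
    modes l (i, true) = !(xor (l.2 i) (xor (prefixParity l.1 i) (l.1 i))) := by
  simp [modes, prefixParity_succ]

/-- The exclusive or of the two bits at qubit `i` is the negation of `l.1 i`. So the modes determine
`l.1`, then its prefix parities, and then `l.2`. -/
theorem modes_injective {n : ℕ} : Function.Injective (modes (n := n)) := by
  rintro ⟨x, z⟩ ⟨x', z'⟩ h
  have h0 : ∀ i, modes (x, z) (i, false) = modes (x', z') (i, false) := fun i => by rw [h]
  have h1 : ∀ i, modes (x, z) (i, true) = modes (x', z') (i, true) := fun i => by rw [h]
  simp only [modes_false, modes_true] at h0 h1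
  have hx : x = x' := by
    funext i
    have e0 := h0 i
    have e1 := h1 i
    revert e0 e1
    generalize z i = a, z' i = b, prefixParity x i = c, prefixParity x' i = d, x i = e, x' i = f
    revert a b c d e f
    decide
  subst hx
  have hz : z = z' := by
    funext i
    simpa using h0 i
  rw [hz]

theorem modes_bijective {n : ℕ} : Function.Bijective (modes (n := n)) := by
  rw [Fintype.bijective_iff_injective_and_card]
  refine ⟨modes_injective, ?_⟩
  simp [pow_mul', sq, ← mul_pow]

/-- Bell states are labelled by sets of Majorana modes. -/
noncomputable def modesEquiv (n : ℕ) : (Bits n × Bits n) ≃ (Site n → Bool) :=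
  Equiv.ofBijective modes modes_bijective

/-- The label obtained by exchanging two modes. -/
noncomputable def swapModes {n : ℕ} (a b : Site n) (l : Bits n × Bits n) : Bits n × Bits n :=
  (modesEquiv n).symm (modes l ∘ Equiv.swap a b)

@[simp] theorem modes_swapModes {n : ℕ} (a b : Site n) (l : Bits n × Bits n) :
    modes (swapModes a b l) = modes l ∘ Equiv.swap a b :=
  (modesEquiv n).apply_symm_apply _

theorem swapModes_eq_of_modes {n : ℕ} {a b : Site n} {l l' : Bits n × Bits n}
    (h : modes l' = modes l ∘ Equiv.swap a b) : swapModes a b l = l' :=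
  modes_injective (by rw [modes_swapModes, h])

theorem swapModes_of_eq {n : ℕ} {a b : Site n} {l : Bits n × Bits n} (h : modes l a = modes l b) :
    swapModes a b l = l := by
  apply swapModes_eq_of_modes
  funext s
  simp only [Function.comp, Equiv.swap_apply_def]
  split_ifs <;> simp_all

theorem swapModes_involutive {n : ℕ} (a b : Site n) : Function.Involutive (swapModes a b) :=
  fun l => swapModes_eq_of_modes (by funext s; simp)

/-! ### Bit flips, Hadamard signs and the orthonormal Bell basis. -/

/-- Flip one bit. -/
def flip {n : ℕ} (i : Fin n) (q : Bits n) : Bits n := Function.update q i (!(q i))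

theorem flip_apply {n : ℕ} (i j : Fin n) (q : Bits n) :
    flip i q j = if j = i then !(q j) else q j := by
  unfold flip; rw [Function.update_apply]; split_ifs with h <;> simp [h]

theorem flip_flip {n : ℕ} (i : Fin n) (q : Bits n) : flip i (flip i q) = q := by
  funext j; simp only [flip_apply]; split_ifs <;> simp

theorem flip_comm {n : ℕ} (i j : Fin n) (q : Bits n) : flip i (flip j q) = flip j (flip i q) := by
  funext k; simp only [flip_apply]; split_ifs <;> simp

/-- Bitwise exclusive or. -/
def bxor {n : ℕ} (p q : Bits n) : Bits n := fun i => xor (p i) (q i)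

theorem bxor_flip_left {n : ℕ} (i : Fin n) (p q : Bits n) : bxor (flip i p) q = flip i (bxor p q) := by
  funext j; simp only [flip_apply, bxor]; split_ifs <;> simp

theorem bxor_flip_right {n : ℕ} (i : Fin n) (p q : Bits n) :
    bxor p (flip i q) = flip i (bxor p q) := by
  funext j; simp only [flip_apply, bxor]; split_ifs <;> simp

theorem flip_eq_iff {n : ℕ} (i : Fin n) (p q : Bits n) : flip i p = q ↔ p = flip i q :=
  ⟨fun h => by rw [← h, flip_flip], fun h => by rw [h, flip_flip]⟩

/-- The entries of the normalized Hadamard transform of all qubits. -/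
noncomputable def chi {n : ℕ} (z q : Bits n) : ℂ :=
  ∏ i, (if z i && q i then (-1 : ℂ) else 1) / (√2 : ℂ)

theorem chi_comm {n : ℕ} (z q : Bits n) : chi z q = chi q z := by
  unfold chi; simp only [Bool.and_comm]

theorem chi_flip_left {n : ℕ} (i : Fin n) (z q : Bits n) :
    chi (flip i z) q = (if q i then -1 else 1) * chi z q := by
  unfold chi
  rw [← Finset.mul_prod_erase _ _ (Finset.mem_univ i),
    ← Finset.mul_prod_erase (a := i) (s := Finset.univ) (h := Finset.mem_univ i)
      (f := fun i => (if z i && q i then (-1 : ℂ) else 1) / (√2 : ℂ)), ← mul_assoc]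
  congr 1
  · rw [flip_apply]
    cases z i <;> cases q i <;> simp [neg_div]
  · refine Finset.prod_congr rfl fun j hj => ?_
    rw [flip_apply, if_neg (Finset.ne_of_mem_erase hj)]

theorem chi_flip_right {n : ℕ} (i : Fin n) (z q : Bits n) :
    chi z (flip i q) = (if z i then -1 else 1) * chi z q := by
  rw [chi_comm, chi_flip_left, chi_comm q]

theorem star_chi {n : ℕ} (z q : Bits n) : star (chi z q) = chi z q := by
  unfold chi
  simp only [star_prod]
  refine Finset.prod_congr rfl fun j _ => ?_
  split_ifs <;> simp

/-- The sum factorises over the qubits, and a qubit where the labels differ contributes the factor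
`1/2 - 1/2 = 0`. -/
theorem sum_chi_mul_chi {n : ℕ} (z z' : Bits n) :
    ∑ q, chi z q * chi z' q = if z = z' then 1 else 0 := by
  unfold chi
  simp only [← Finset.prod_mul_distrib]
  have h := Finset.prod_univ_sum (fun _ : Fin n => (Finset.univ : Finset Bool)) (fun i b =>
    ((if z i && b then (-1 : ℂ) else 1) / (√2 : ℂ)) *
      ((if z' i && b then (-1 : ℂ) else 1) / (√2 : ℂ)))
  rw [Fintype.piFinset_univ] at h
  rw [← h]
  have h2 : (√2 : ℂ) * (√2 : ℂ) = 2 := by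
    rw [← Complex.ofReal_mul, Real.mul_self_sqrt (by norm_num)]; norm_num
  have hf : ∀ i, ∑ b : Bool, ((if z i && b then (-1 : ℂ) else 1) / (√2 : ℂ)) *
      ((if z' i && b then (-1 : ℂ) else 1) / (√2 : ℂ)) = if z i = z' i then 1 else 0 := by
    intro i
    simp only [div_mul_div_comm, h2]
    cases z i <;> cases z' i <;> norm_num
  simp only [hf]
  split_ifs with hz
  · simp [hz]
  · obtain ⟨i, hi⟩ := Function.ne_iff.mp hz
    exact Finset.prod_eq_zero (Finset.mem_univ i) (by simp [hi])

/-- The Bell state with a given label, as an operator from the second copy to the first: a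
normalized Pauli string. -/
noncomputable def bell {n : ℕ} (l : Bits n × Bits n) : Matrix (Bits n) (Bits n) ℂ :=
  Matrix.of fun p q => if p = bxor q l.1 then chi l.2 q else 0

/-- The unitary matrix of which the columns are the Bell states. -/
noncomputable def bellMatrix (n : ℕ) : Matrix (Bits n × Bits n) (Bits n × Bits n) ℂ :=
  Matrix.of fun p l => bell l p.1 p.2

theorem bxor_right_injective {n : ℕ} {q x x' : Bits n} (h : bxor q x = bxor q x') : x = x' := by
  funext i
  have := congrFun h i
  simpa [bxor] using this

theorem bellMatrix_conjTranspose_mul (n : ℕ) : (bellMatrix n)ᴴ * bellMatrix n = 1 := by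
  ext l l'
  rw [Matrix.mul_apply, Fintype.sum_prod_type_right]
  simp only [Matrix.conjTranspose_apply, bellMatrix, bell, Matrix.of_apply]
  have h : ∀ q : Bits n, ∑ p : Bits n, star (if p = bxor q l.1 then chi l.2 q else 0) *
      (if p = bxor q l'.1 then chi l'.2 q else 0) =
      if l.1 = l'.1 then chi l.2 q * chi l'.2 q else 0 := by
    intro q
    rw [Finset.sum_eq_single (bxor q l.1) (fun p _ hp => by simp [hp]) (by simp)]
    by_cases hx : l.1 = l'.1
    · simp only [hx, if_true]; rw [star_chi]
    · simpa [hx] using fun h => absurd (bxor_right_injective h) hx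
  simp only [h]
  rw [Matrix.one_apply]
  by_cases hx : l.1 = l'.1
  · simp only [hx, if_true, sum_chi_mul_chi, Prod.ext_iff, true_and]
  · simp [hx, Prod.ext_iff]

theorem bellMatrix_mul_conjTranspose (n : ℕ) : bellMatrix n * (bellMatrix n)ᴴ = 1 :=
  mul_eq_one_comm.mp (bellMatrix_conjTranspose_mul n)

/-! ### The generators -/

theorem pauliX_mul_apply {n : ℕ} (i : Fin n) (M : Matrix (Bits n) (Bits n) ℂ) (p q : Bits n) :
    (pauliX i * M) p q = M (flip i p) q := by
  rw [Matrix.mul_apply, Finset.sum_eq_single (flip i p)]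
  · simp only [pauliX, Matrix.of_apply]
    change (if p = flip i (flip i p) then (1 : ℂ) else 0) * _ = _
    rw [flip_flip, if_pos rfl, one_mul]
  · intro b _ hb
    simp only [pauliX, Matrix.of_apply]
    change (if p = flip i b then (1 : ℂ) else 0) * _ = _
    rw [if_neg (fun h => hb ((flip_eq_iff i p b).mpr h).symm), zero_mul]
  · simp

theorem mul_pauliX_apply {n : ℕ} (i : Fin n) (M : Matrix (Bits n) (Bits n) ℂ) (p q : Bits n) :
    (M * pauliX i) p q = M p (flip i q) := by
  rw [Matrix.mul_apply, Finset.sum_eq_single (flip i q)]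
  · simp only [pauliX, Matrix.of_apply]
    change _ * (if flip i q = flip i q then (1 : ℂ) else 0) = _
    rw [if_pos rfl, mul_one]
  · intro b _ hb
    simp only [pauliX, Matrix.of_apply]
    change _ * (if b = flip i q then (1 : ℂ) else 0) = _
    rw [if_neg hb, mul_zero]
  · simp

/-- Multiplication by a Pauli operator from the left and from the right leads to the same label and
differs only by a sign. Comparing the signs decides between commuting and anticommuting. -/
theorem pauliZ_mul_bell {n : ℕ} (i : Fin n) (l : Bits n × Bits n) :
    pauliZ i * bell l = (if l.1 i then -1 else 1 : ℂ) • bell (l.1, flip i l.2) := by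
  ext p q
  simp only [pauliZ, Matrix.diagonal_mul, bell, Matrix.of_apply, Matrix.smul_apply, chi_flip_left,
    smul_eq_mul]
  by_cases h : p = bxor q l.1
  · rw [if_pos h, if_pos h, h, bxor]
    cases q i <;> cases l.1 i <;> simp
  · simp [h]

theorem bell_mul_pauliZ {n : ℕ} (i : Fin n) (l : Bits n × Bits n) :
    bell l * pauliZ i = bell (l.1, flip i l.2) := by
  ext p q
  simp only [pauliZ, Matrix.mul_diagonal, bell, Matrix.of_apply, chi_flip_left]
  split_ifs <;> simp

theorem pauliX_mul_bell {n : ℕ} (i : Fin n) (l : Bits n × Bits n) :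
    pauliX i * bell l = bell (flip i l.1, l.2) := by
  ext p q
  simp only [pauliX_mul_apply, bell, Matrix.of_apply, flip_eq_iff, bxor_flip_right]

theorem bell_mul_pauliX {n : ℕ} (i : Fin n) (l : Bits n × Bits n) :
    bell l * pauliX i = (if l.2 i then -1 else 1 : ℂ) • bell (flip i l.1, l.2) := by
  ext p q
  simp only [mul_pauliX_apply, bell, Matrix.of_apply, bxor_flip_left, bxor_flip_right,
    chi_flip_right, Matrix.smul_apply, smul_eq_mul, mul_ite, mul_zero]

theorem pauliZ_mul_self {n : ℕ} (i : Fin n) : (pauliZ i : Matrix (Bits n) (Bits n) ℂ) * pauliZ i = 1 := by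
  rw [pauliZ, Matrix.diagonal_mul_diagonal, ← Matrix.diagonal_one]
  congr 1; funext x; split_ifs <;> simp

theorem pauliX_mul_self {n : ℕ} (i : Fin n) : (pauliX i : Matrix (Bits n) (Bits n) ℂ) * pauliX i = 1 := by
  ext p q
  rw [pauliX_mul_apply, Matrix.one_apply]
  simp only [pauliX, Matrix.of_apply]
  congr 1
  exact propext ⟨fun h => (flip_eq_iff i p _).mp h |>.trans (flip_flip i q),
    fun h => by rw [h]; rfl⟩

theorem pauliX_comm {n : ℕ} (i j : Fin n) :
    (pauliX i : Matrix (Bits n) (Bits n) ℂ) * pauliX j = pauliX j * pauliX i := by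
  ext p q
  rw [pauliX_mul_apply, mul_pauliX_apply]
  simp only [pauliX, Matrix.of_apply]
  congr 1
  exact propext (flip_eq_iff i p (flip j q) |>.trans (by
    rw [flip_comm]; rfl))

theorem pauliX_transpose {n : ℕ} (i : Fin n) : (pauliX i : Matrix (Bits n) (Bits n) ℂ)ᵀ = pauliX i := by
  ext p q
  simp only [pauliX, Matrix.of_apply, Matrix.transpose_apply]
  congr 1
  exact propext ⟨fun h => ((flip_eq_iff i p q).mp h.symm), fun h => ((flip_eq_iff i p q).mpr h).symm⟩

theorem pauliX_conjTranspose {n : ℕ} (i : Fin n) :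
    (pauliX i : Matrix (Bits n) (Bits n) ℂ)ᴴ = pauliX i := by
  rw [Matrix.conjTranspose, pauliX_transpose]
  ext p q
  simp only [pauliX, Matrix.of_apply, Matrix.map_apply]
  split_ifs <;> simp

theorem pauliZ_conjTranspose {n : ℕ} (i : Fin n) :
    (pauliZ i : Matrix (Bits n) (Bits n) ℂ)ᴴ = pauliZ i := by
  rw [pauliZ, Matrix.diagonal_conjTranspose]
  congr 1
  funext x
  simp only [Pi.star_apply]
  split_ifs <;> simp

/-- Consequently flipping the neighbouring bits `i` and `i + 1` alters only the prefix parity of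
length `i + 1`. This is why `X_i X_{i+1}` affects just two sites. -/
theorem prefixParity_flip_lt {n : ℕ} (x : Bits n) (i : Fin n) (k : ℕ) :
    prefixParity (flip i x) k = xor (prefixParity x k) (decide ((i : ℕ) < k)) := by
  induction k with
  | zero => simp [prefixParity]
  | succ k ih =>
    simp only [prefixParity, ih]
    by_cases hk : k < n
    · simp only [hk, dif_pos, flip_apply, Fin.ext_iff]
      have h1 : (decide ((i : ℕ) < k + 1)) = xor (decide ((i : ℕ) < k)) (decide (k = i)) := by grind
      rw [h1]
      by_cases hki : k = i
      · simp [hki]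
      · simp [hki]; grind
    · have : (i : ℕ) < k := by omega
      simp [hk, this, Nat.lt_succ_of_lt this]

/-! ### Generators as exchanges of neighbouring modes. -/

/-- A generator acts on Bell states as the exchange of two neighbouring modes. -/
structure ActsAsSwap {n : ℕ} (H : Matrix (Bits n) (Bits n) ℂ) (a b : Site n) : Prop where
  mul_self : H * H = 1
  transpose_eq : Hᵀ = H
  conjTranspose_eq : Hᴴ = H
  anticomm : ∀ l, modes l a = modes l b → H * bell l = -(bell l * H)
  comm : ∀ l, modes l a ≠ modes l b → ∃ c : ℂ, ‖c‖ = 1 ∧ H * bell l = c • bell (swapModes a b l) ∧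
    bell l * H = c • bell (swapModes a b l)

/-- `Z_i` commutes with the Pauli string exactly if `l.1 i` is false. The negation in `modes` turns
this into the condition that the two modes of the qubit differ. -/
theorem actsAsSwap_pauliZ {n : ℕ} (i : Fin n) : ActsAsSwap (pauliZ i) (i, false) (i, true) where
  mul_self := pauliZ_mul_self i
  transpose_eq := by simp [pauliZ]
  conjTranspose_eq := pauliZ_conjTranspose i
  anticomm l h := by
    have hx : l.1 i = true := by rw [modes_false, modes_true] at h; grind
    rw [pauliZ_mul_bell, bell_mul_pauliZ, hx]; simp
  comm l h := by
    have hx : l.1 i = false := by rw [modes_false, modes_true] at h; grind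
    have hs : swapModes (i, false) (i, true) l = (l.1, flip i l.2) := by
      apply swapModes_eq_of_modes
      funext ⟨j, b⟩
      simp only [Function.comp]
      by_cases hj : j = i
      · subst hj
        cases b <;> simp [modes_false, modes_true, flip_apply, hx] 
      · rw [Equiv.swap_apply_of_ne_of_ne (by simp [hj]) (by simp [hj])]
        cases b <;> simp [modes_false, modes_true, flip_apply, hj]
    refine ⟨1, by simp, ?_, ?_⟩
    · rw [pauliZ_mul_bell, hs, hx]; simp
    · rw [bell_mul_pauliZ, hs]; simp

/-- `X_i X_j` commutes with the Pauli string exactly if `l.2 i = l.2 j`. As the sites `(i, true)`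
and `(j, false)` involve the same prefix parity, this again says that the two modes differ. -/
theorem actsAsSwap_pauliX {n : ℕ} (i j : Fin n) (hij : (j : ℕ) = i + 1) :
    ActsAsSwap (pauliX i * pauliX j) (i, true) (j, false) where
  mul_self := by
    rw [mul_assoc, pauliX_comm i j, ← mul_assoc (pauliX j), pauliX_mul_self, one_mul,
      pauliX_mul_self]
  transpose_eq := by rw [Matrix.transpose_mul, pauliX_transpose, pauliX_transpose, pauliX_comm]
  conjTranspose_eq := by
    rw [Matrix.conjTranspose_mul, pauliX_conjTranspose, pauliX_conjTranspose, pauliX_comm]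
  anticomm l h := by
    have hx : l.2 i = !(l.2 j) := by
      rw [modes_false, modes_true, hij, prefixParity_succ] at h; grind
    rw [mul_assoc, pauliX_mul_bell, pauliX_mul_bell, ← mul_assoc, bell_mul_pauliX, Matrix.smul_mul,
      bell_mul_pauliX, smul_smul, hx, flip_comm j i]
    cases l.2 j <;> simp
  comm l h := by
    have hx : l.2 i = l.2 j := by
      rw [modes_false, modes_true, hij, prefixParity_succ] at h; grind
    have hs : swapModes (i, true) (j, false) l = (flip i (flip j l.1), l.2) := by
      have hne : i ≠ j := by intro h; rw [h] at hij; omega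
      apply swapModes_eq_of_modes
      funext ⟨k, b⟩
      simp only [Function.comp]
      have e1 : modes l (i, true) = !(modes l (j, false)) := by grind
      -- As the two modes differ, exchanging them is the same as negating both.
      have key : modes (flip i (flip j l.1), l.2) (k, b) =
          xor (modes l (k, b)) (decide ((k, b) = (i, true) ∨ (k, b) = (j, false))) := by
        cases b
        · simp only [modes_false, prefixParity_flip_lt]
          have : decide ((k, false) = (i, true) ∨ (k, false) = (j, false)) =
              xor (decide ((i : ℕ) < k)) (decide ((j : ℕ) < k)) := by
            simp only [Prod.mk.injEq, Fin.ext_iff]; grind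
          rw [this]; grind
        · simp only [modes, prefixParity_flip_lt, if_true]
          have : decide ((k, true) = (i, true) ∨ (k, true) = (j, false)) =
              xor (decide ((i : ℕ) < k + 1)) (decide ((j : ℕ) < k + 1)) := by
            simp only [Prod.mk.injEq, Fin.ext_iff]; grind
          rw [this]; grind
      rw [key, Equiv.swap_apply_def]
      split_ifs with h1 h2
      · simp [h1, e1]
      · rw [h2, e1]; simp
      · simp [h1, h2]
    refine ⟨1, by simp, ?_, ?_⟩
    · rw [mul_assoc, pauliX_mul_bell, pauliX_mul_bell, hs]; simp
    · rw [← mul_assoc, bell_mul_pauliX, Matrix.smul_mul, bell_mul_pauliX, smul_smul, hs, hx,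
        flip_comm j i]
      cases l.2 j <;> simp

theorem actsAsSwap_of_mem_generators {n : ℕ} {H : Matrix (Bits n) (Bits n) ℂ}
    (hH : H ∈ generators n) : ∃ a b : Site n, b.pos = a.pos + 1 ∧ ActsAsSwap H a b := by
  rcases hH with ⟨i, rfl⟩ | ⟨i, j, hij, rfl⟩
  · exact ⟨_, _, by simp [Site.pos], actsAsSwap_pauliZ i⟩
  · exact ⟨_, _, by simp [Site.pos]; omega, actsAsSwap_pauliX i j hij⟩

theorem exists_generator_actsAsSwap {n : ℕ} {a b : Site n} (h : b.pos = a.pos + 1) :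
    ∃ H ∈ generators n, ActsAsSwap H a b := by
  obtain ⟨i, ba⟩ := a
  obtain ⟨j, bb⟩ := b
  simp only [Site.pos] at h
  cases ba <;> cases bb <;> simp only [Bool.toNat_false, Bool.toNat_true] at h
  · omega
  · obtain rfl : j = i := Fin.ext (by omega)
    exact ⟨_, Or.inl ⟨_, rfl⟩, actsAsSwap_pauliZ _⟩
  · exact ⟨_, Or.inr ⟨i, j, by omega, rfl⟩, actsAsSwap_pauliX i j (by omega)⟩
  · omega

end Matchgate

namespace Matchgate

/-! ### Counting sets of modes -/

/-- The number of modes in a set. -/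
def numModes {n : ℕ} (t : Site n → Bool) : ℕ := ∑ s, (t s).toNat

/-- The sum of the positions of the modes in a set. -/
def weight {n : ℕ} (t : Site n → Bool) : ℕ := ∑ s, (t s).toNat * s.pos

theorem numModes_comp {n : ℕ} (t : Site n → Bool) (σ : Equiv.Perm (Site n)) :
    numModes (t ∘ σ) = numModes t :=
  Equiv.sum_comp σ fun s => (t s).toNat

/-- Only a mode at `a` moves up, and by one place; a mode at `b` moves down. -/
theorem weight_comp_swap_le {n : ℕ} (t : Site n → Bool) {a b : Site n} (h : b.pos = a.pos + 1) :
    weight (t ∘ Equiv.swap a b) ≤ weight t + 1 := by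
  have h1 : weight (t ∘ Equiv.swap a b) = ∑ s, (t s).toNat * (Equiv.swap a b s).pos := by
    rw [← Equiv.sum_comp (Equiv.swap a b)]
    simp [weight]
  have h2 : ∀ s, (t s).toNat * (Equiv.swap a b s).pos ≤
      (t s).toNat * s.pos + if s = a then 1 else 0 := by
    intro s
    have ht : (t s).toNat ≤ 1 := Bool.toNat_le _
    rw [Equiv.swap_apply_def]
    split_ifs with h1 h2
    · rw [h1] at ht ⊢; rw [h, mul_add]; omega
    · rw [h2, h, mul_add]; exact Nat.le_trans (Nat.le_add_right _ _) (Nat.le_add_right _ _)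
    · simp
  calc weight (t ∘ Equiv.swap a b) ≤ ∑ s, ((t s).toNat * s.pos + if s = a then 1 else 0) :=
        h1.trans_le (Finset.sum_le_sum fun s _ => h2 s)
    _ = weight t + 1 := by rw [Finset.sum_add_distrib]; simp [weight]

theorem sum_site {M : Type*} [AddCommMonoid M] (n : ℕ) (f : ℕ → M) :
    ∑ s : Site n, f s.pos = ∑ k ∈ Finset.range (2 * n), f k := by
  rw [Fintype.sum_prod_type]
  simp only [Site.pos, Fintype.sum_bool, Bool.toNat_true, Bool.toNat_false]
  rw [Fin.sum_univ_eq_sum_range (fun i => f (2 * i + 1) + f (2 * i + 0)) n]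
  induction n with
  | zero => simp
  | succ n ih =>
    rw [Finset.sum_range_succ, ih, show 2 * (n + 1) = 2 * n + 1 + 1 by ring, Finset.sum_range_succ,
      Finset.sum_range_succ, add_assoc, add_comm (f (2 * n + 1))]
    rfl

/-- The first `n` of the `2 n` modes. -/
def firstModes (n : ℕ) (s : Site n) : Bool := decide (s.pos < n)

theorem numModes_firstModes (n : ℕ) : numModes (firstModes n) = n := by
  unfold numModes firstModes
  rw [sum_site n (fun k => (decide (k < n)).toNat), two_mul, Finset.sum_range_add,
    Finset.sum_congr rfl (g := fun _ => 1) (fun k hk => by simp [Finset.mem_range.mp hk])]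
  simp

/-- Weights are compared through `2 * weight + n`, which avoids halves and truncated subtraction: it
is `n ^ 2` at the start and `2 * n ^ 2` at the midpoint. -/
theorem weight_firstModes (n : ℕ) : 2 * weight (firstModes n) + n = n ^ 2 := by
  unfold weight firstModes
  rw [sum_site n (fun k => (decide (k < n)).toNat * k), two_mul n, Finset.sum_range_add,
    Finset.sum_congr rfl (g := fun k => k) (fun k hk => by simp [Finset.mem_range.mp hk])]
  have h := Finset.sum_range_id_mul_two n
  have h' : ∑ x ∈ Finset.range n, (decide (n + x < n)).toNat * (n + x) = 0 :=
    Finset.sum_eq_zero fun x _ => by simp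
  rw [h', add_zero, mul_comm, h]
  cases n <;> simp; ring

/-- The reflection of the line of modes. -/
def reflect (n : ℕ) : Equiv.Perm (Site n) :=
  Function.Involutive.toPerm (fun s => (Fin.rev s.1, !s.2)) fun s => by simp

theorem reflect_apply {n : ℕ} (s : Site n) : reflect n s = (Fin.rev s.1, !s.2) := rfl

theorem reflect_reflect {n : ℕ} (s : Site n) : reflect n (reflect n s) = s := by
  simp [reflect_apply]

theorem reflect_symm (n : ℕ) : (reflect n).symm = reflect n := by
  ext1 s
  rw [Equiv.symm_apply_eq, reflect_reflect]

theorem pos_reflect {n : ℕ} (s : Site n) : s.pos + (reflect n s).pos + 1 = 2 * n := by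
  obtain ⟨i, b⟩ := s
  have := i.2
  cases b <;> simp [reflect_apply, Site.pos, Fin.val_rev] <;> omega

theorem weight_comp_reflect {n : ℕ} (t : Site n → Bool) :
    weight t + weight (t ∘ reflect n) + numModes t = numModes t * (2 * n) := by
  have h1 : weight (t ∘ reflect n) = ∑ s, (t s).toNat * (reflect n s).pos := by
    rw [← Equiv.sum_comp (reflect n)]
    simp [weight, reflect_reflect]
  rw [h1, weight, numModes, ← Finset.sum_add_distrib, ← Finset.sum_add_distrib, Finset.sum_mul]
  exact Finset.sum_congr rfl fun s _ => by rw [← pos_reflect s]; ring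

/-- For `n = 2m`, occupying the first `m` and the last `m` of the `4m` sites gives a set that is its
own reflection. -/
theorem exists_balanced {n : ℕ} (h : Even n) :
    ∃ t : Site n → Bool, numModes t = n ∧ 2 * weight t + n = 2 * n ^ 2 := by
  obtain ⟨m, rfl⟩ := h
  have hr : ∀ s : Site (m + m), (decide ((reflect _ s).pos < m ∨ 3 * m ≤ (reflect _ s).pos)) =
      decide (s.pos < m ∨ 3 * m ≤ s.pos) := by
    intro s
    have := pos_reflect s
    have e : ((reflect _ s).pos < m ∨ 3 * m ≤ (reflect _ s).pos) ↔ (s.pos < m ∨ 3 * m ≤ s.pos) := by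
      omega
    simp only [e]
  set t : Site (m + m) → Bool := fun s => decide (s.pos < m ∨ 3 * m ≤ s.pos) with ht
  have hn : numModes t = m + m := by
    unfold numModes
    rw [ht, sum_site (m + m) (fun k => (decide (k < m ∨ 3 * m ≤ k)).toNat),
      show 2 * (m + m) = m + (m + m) + m by ring, Finset.sum_range_add, Finset.sum_range_add]
    have e1 : ∀ k ∈ Finset.range m, (decide (k < m ∨ 3 * m ≤ k)).toNat = 1 := fun k hk => by
      have := Finset.mem_range.mp hk
      rw [decide_eq_true (by omega), Bool.toNat_true]
    have e2 : ∀ k ∈ Finset.range (m + m), (decide (m + k < m ∨ 3 * m ≤ m + k)).toNat = 0 :=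
      fun k hk => by
        have := Finset.mem_range.mp hk
        rw [decide_eq_false (by omega), Bool.toNat_false]
    have e3 : ∀ k ∈ Finset.range m,
        (decide (m + (m + m) + k < m ∨ 3 * m ≤ m + (m + m) + k)).toNat = 1 := fun k hk => by
      rw [decide_eq_true (by omega), Bool.toNat_true]
    rw [Finset.sum_congr rfl e1, Finset.sum_congr rfl e2, Finset.sum_congr rfl e3]
    simp
  refine ⟨t, hn, ?_⟩
  have h := weight_comp_reflect t
  rw [show t ∘ reflect _ = t from funext hr, hn] at h
  linarith [h, show (m + m) * (2 * (m + m)) = 2 * (m + m) ^ 2 by ring]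

/-! ### Permutation-invariant distributions of mode sets. -/

theorem Site.pos_injective {n : ℕ} : Function.Injective (Site.pos (n := n)) := by
  rintro ⟨i, a⟩ ⟨j, b⟩ h
  cases a <;> cases b <;> simp [Site.pos, Fin.ext_iff] at h ⊢ <;> omega

theorem Site.exists_pos_eq {n k : ℕ} (h : k < 2 * n) : ∃ s : Site n, s.pos = k := by
  refine ⟨(⟨k / 2, by omega⟩, decide (k % 2 = 1)), ?_⟩
  rcases Nat.mod_two_eq_zero_or_one k with h | h <;> simp [Site.pos, h] <;> omega

theorem Site.pos_lt {n : ℕ} (s : Site n) : s.pos < 2 * n := by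
  have := pos_reflect s
  omega

/-- Exchanges of neighbours generate all permutations: a transposition over distance `k + 1` is one
over distance `k` conjugated by an exchange of neighbours. -/
theorem invariant_perm {n : ℕ} {α : Type*} {p : (Site n → Bool) → α}
    (hp : ∀ a b : Site n, b.pos = a.pos + 1 → ∀ t, p (t ∘ Equiv.swap a b) = p t)
    (σ : Equiv.Perm (Site n)) (t : Site n → Bool) : p (t ∘ σ) = p t := by
  have key : ∀ (k : ℕ) (a b : Site n), b.pos = a.pos + k → ∀ t, p (t ∘ Equiv.swap a b) = p t := by
    intro k
    induction k with
    | zero =>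
      intro a b h t
      rw [Site.pos_injective h]; simp
    | succ k ih =>
      intro a b h t
      by_cases hk : k = 0
      · exact hp a b (by omega) t
      · obtain ⟨c, hc⟩ := Site.exists_pos_eq (n := n) (k := a.pos + k) (by have := b.pos_lt; omega)
        have hac : a ≠ c := by rintro rfl; omega
        have hab : a ≠ b := by rintro rfl; omega
        have e : Equiv.swap a b = Equiv.swap c b * Equiv.swap a c * Equiv.swap c b := by
          rw [Equiv.swap_mul_swap_mul_swap hac hab, Equiv.swap_comm]
        rw [e]
        have hcb := hp c b (by omega)
        rw [Equiv.Perm.coe_mul, Equiv.Perm.coe_mul, ← Function.comp_assoc, hcb,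
          ← Function.comp_assoc, ih a c hc, hcb]
  have swaps : ∀ a b : Site n, ∀ t, p (t ∘ Equiv.swap a b) = p t := by
    intro a b t
    rcases le_total a.pos b.pos with h | h
    · exact key (b.pos - a.pos) a b (by omega) t
    · rw [Equiv.swap_comm]; exact key (a.pos - b.pos) b a (by omega) t
  induction σ using Equiv.Perm.swap_induction_on generalizing t with
  | one => rfl
  | swap_mul f x y hxy ih => rw [Equiv.Perm.coe_mul, ← Function.comp_assoc, ih, swaps]

theorem exists_perm_of_numModes_eq {n : ℕ} {t t' : Site n → Bool} (h : numModes t = numModes t') :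
    ∃ σ : Equiv.Perm (Site n), t' ∘ σ = t := by
  have hc : ∀ t : Site n → Bool, numModes t = Fintype.card {s // t s = true} := by
    intro t
    rw [Fintype.card_subtype, Finset.card_filter, numModes]
    exact Finset.sum_congr rfl fun s _ => by cases t s <;> rfl
  rw [hc, hc] at h
  let e := Fintype.equivOfCardEq h
  refine ⟨e.extendSubtype, funext fun s => ?_⟩
  by_cases hs : t s = true
  · exact (e.extendSubtype_mem s hs).trans hs.symm
  · have := e.extendSubtype_not_mem s hs
    simp only [Function.comp]
    grind

/-- Here `p` stands for the Haar distribution of the mode set. Reflection preserves `p` and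
exchanges sets below and above the midpoint, so both sides have equal probability. For even `n` the
midpoint itself has positive probability, because `p` is constant on the sets of `n` modes. -/
theorem sum_light_le_half {n : ℕ} {p : (Site n → Bool) → ℝ} (h0 : ∀ t, 0 ≤ p t) (h1 : ∑ t, p t = 1)
    (hn : ∀ t, numModes t ≠ n → p t = 0)
    (hp : ∀ a b : Site n, b.pos = a.pos + 1 → ∀ t, p (t ∘ Equiv.swap a b) = p t) :
    ∑ t, (if 2 * weight t + n < 2 * n ^ 2 then p t else 0) ≤ 1 / 2 ∧
      (Even n → ∑ t, (if 2 * weight t + n < 2 * n ^ 2 then p t else 0) < 1 / 2) := by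
  have hinv := invariant_perm hp
  have hrev : ∑ t, (if 2 * weight t + n < 2 * n ^ 2 then p t else 0) =
      ∑ t, (if 2 * n ^ 2 < 2 * weight t + n then p t else 0) := by
    rw [← Equiv.sum_comp (Equiv.arrowCongr (reflect n) (Equiv.refl Bool))]
    refine Finset.sum_congr rfl fun t _ => ?_
    have e : (Equiv.arrowCongr (reflect n) (Equiv.refl Bool)) t = t ∘ reflect n := by
      funext s; simp [reflect_symm]
    rw [e, hinv]
    by_cases ht : numModes t = n
    · have := weight_comp_reflect t
      rw [ht] at this
      have hw : 2 * weight t + n + (2 * weight (t ∘ reflect n) + n) = 2 * n ^ 2 + 2 * n ^ 2 := by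
        linarith
      congr 1
      exact propext (by omega)
    · simp [hn t ht]
  have htot : ∑ t, (if 2 * weight t + n < 2 * n ^ 2 then p t else 0) +
      ∑ t, (if 2 * n ^ 2 < 2 * weight t + n then p t else 0) +
      ∑ t, (if 2 * weight t + n = 2 * n ^ 2 then p t else 0) = 1 := by
    rw [← h1, ← Finset.sum_add_distrib, ← Finset.sum_add_distrib]
    refine Finset.sum_congr rfl fun t _ => ?_
    rcases lt_trichotomy (2 * weight t + n) (2 * n ^ 2) with h | h | h
    · simp [h, h.ne, h.not_gt]
    · simp [h]
    · simp [h, h.ne', h.not_gt]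
  have hge : ∀ t, 0 ≤ (if 2 * weight t + n = 2 * n ^ 2 then p t else 0) := by
    intro t; split_ifs; exacts [h0 t, le_rfl]
  refine ⟨by linarith [Finset.sum_nonneg fun t (_ : t ∈ Finset.univ) => hge t], fun he => ?_⟩
  obtain ⟨t, ht, hw⟩ := exists_balanced he
  have hpos : 0 < p t := by
    refine (h0 t).lt_of_ne' fun hz => ?_
    have : ∑ t, p t = 0 := Finset.sum_eq_zero fun u _ => by
      by_cases hu : numModes u = n
      · obtain ⟨σ, rfl⟩ := exists_perm_of_numModes_eq (hu.trans ht.symm)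
        rw [hinv, hz]
      · exact hn u hu
    linarith
  have := Finset.sum_pos' (fun t _ => hge t) ⟨t, Finset.mem_univ t, by simpa [hw] using hpos⟩
  linarith

end Matchgate

namespace Matchgate

/-! ### Amplitudes of a matchgate circuit between Bell states -/

/-- Split along the projections `(1 ± H) / 2`, on which `H` acts as `±1`; the exponential series
then becomes two scalar ones. -/
theorem exp_smul_of_mul_self {m : Type*} [Fintype m] [DecidableEq m] {H : Matrix m m ℂ}
    (hH : H * H = 1) (c : ℂ) :
    NormedSpace.exp (c • H) = Complex.cosh c • (1 : Matrix m m ℂ) + Complex.sinh c • H := by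
  let _ : NormedRing (Matrix m m ℂ) := Matrix.linftyOpNormedRing
  let _ : NormedAlgebra ℂ (Matrix m m ℂ) := Matrix.linftyOpNormedAlgebra
  have hpow : ∀ k : ℕ, H ^ k = (1 / 2 : ℂ) • (1 + H) + (-1 : ℂ) ^ k • (1 / 2 : ℂ) • (1 - H) := by
    intro k
    induction k with
    | zero => rw [pow_zero, pow_zero, one_smul, ← smul_add]; module
    | succ k ih =>
      rw [pow_succ, ih, add_mul, Matrix.smul_mul, Matrix.smul_mul, Matrix.smul_mul, add_mul, sub_mul,
        hH, one_mul, pow_succ]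
      module
  have h1 : HasSum (fun k : ℕ => ((k.factorial : ℂ)⁻¹) • (c • H) ^ k) (NormedSpace.exp (c • H)) :=
    NormedSpace.exp_series_hasSum_exp' (𝕂 := ℂ) (c • H)
  have h2 : HasSum (fun k : ℕ => ((k.factorial : ℂ)⁻¹) • c ^ k) (Complex.exp c) := by
    rw [Complex.exp_eq_exp_ℂ]; exact NormedSpace.exp_series_hasSum_exp' (𝕂 := ℂ) c
  have h3 : HasSum (fun k : ℕ => ((k.factorial : ℂ)⁻¹) • (-c) ^ k) (Complex.exp (-c)) := by
    rw [Complex.exp_eq_exp_ℂ]; exact NormedSpace.exp_series_hasSum_exp' (𝕂 := ℂ) (-c)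
  have h4 := (h2.smul_const ((1 / 2 : ℂ) • (1 + H))).add (h3.smul_const ((1 / 2 : ℂ) • (1 - H)))
  have h5 : (fun k : ℕ => ((k.factorial : ℂ)⁻¹ • c ^ k) • ((1 / 2 : ℂ) • (1 + H)) +
      ((k.factorial : ℂ)⁻¹ • (-c) ^ k) • ((1 / 2 : ℂ) • (1 - H))) =
      fun k : ℕ => ((k.factorial : ℂ)⁻¹) • (c • H) ^ k := by
    funext k
    rw [smul_pow, hpow, neg_pow c k]
    module
  rw [h5] at h4
  rw [h1.unique h4, Complex.cosh, Complex.sinh]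
  module

/-- The amplitudes of `U ⊗ U` between Bell states. -/
noncomputable def amp {n : ℕ} (U : Uni n) : Matrix (Bits n × Bits n) (Bits n × Bits n) ℂ :=
  (bellMatrix n)ᴴ * ((U : Matrix (Bits n) (Bits n) ℂ) ⊗ₖ (U : Matrix (Bits n) (Bits n) ℂ)) *
    bellMatrix n

theorem amp_one {n : ℕ} : amp (1 : Uni n) = 1 := by
  simp [amp, bellMatrix_conjTranspose_mul]

theorem amp_mul {n : ℕ} (U V : Uni n) : amp (U * V) = amp U * amp V := by
  have h : ∀ A B C D E : Matrix (Bits n × Bits n) (Bits n × Bits n) ℂ,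
      A * B * C * (D * E * A) = A * B * (C * D) * (E * A) := fun A B C D E => by
    simp only [mul_assoc]
  have h' : amp U * amp V = (bellMatrix n)ᴴ *
      ((U : Matrix (Bits n) (Bits n) ℂ) ⊗ₖ (U : Matrix (Bits n) (Bits n) ℂ)) *
      (bellMatrix n * (bellMatrix n)ᴴ) *
      (((V : Matrix (Bits n) (Bits n) ℂ) ⊗ₖ (V : Matrix (Bits n) (Bits n) ℂ)) * bellMatrix n) := by
    simp only [amp, mul_assoc]
  rw [h', bellMatrix_mul_conjTranspose, mul_one, amp, Matrix.UnitaryGroup.mul_val,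
    Matrix.mul_kronecker_mul]
  simp only [mul_assoc]

theorem amp_inv {n : ℕ} (U : Uni n) : amp U⁻¹ = (amp U)ᴴ := by
  rw [amp, amp, Matrix.conjTranspose_mul, Matrix.conjTranspose_mul, Matrix.conjTranspose_conjTranspose,
    Matrix.conjTranspose_kronecker, mul_assoc]
  rfl

theorem sum_norm_amp_sq {n : ℕ} (U : Uni n) (l : Bits n × Bits n) : ∑ k, ‖amp U k l‖ ^ 2 = 1 := by
  have h : (amp U)ᴴ * amp U = 1 := by rw [← amp_inv, ← amp_mul, inv_mul_cancel, amp_one]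
  have h' := congrFun (congrFun h l) l
  rw [Matrix.mul_apply, Matrix.one_apply_eq] at h'
  simp only [Matrix.conjTranspose_apply, RCLike.star_def, Complex.conj_mul'] at h'
  exact_mod_cast h'

/-- Operators on one copy serve as vectors of two copies; this turns `U ⊗ U` into `B ↦ U B Uᵀ`. -/
theorem kronecker_mul_bellMatrix {n : ℕ} (U : Matrix (Bits n) (Bits n) ℂ) (p l : Bits n × Bits n) :
    ((U ⊗ₖ U) * bellMatrix n) p l = (U * bell l * Uᵀ) p.1 p.2 := by
  rw [Matrix.mul_apply, Fintype.sum_prod_type_right, Matrix.mul_apply]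
  refine Finset.sum_congr rfl fun q _ => ?_
  rw [Matrix.mul_apply, Finset.sum_mul]
  refine Finset.sum_congr rfl fun r _ => ?_
  simp only [Matrix.kroneckerMap_apply, bellMatrix, Matrix.of_apply, Matrix.transpose_apply]
  ring

theorem amp_of_conj_bell {n : ℕ} {U : Uni n} {l k m : Bits n × Bits n} {c d : ℂ}
    (h : (U : Matrix (Bits n) (Bits n) ℂ) * bell l * (U : Matrix (Bits n) (Bits n) ℂ)ᵀ =
      c • bell k + d • bell m) (l' : Bits n × Bits n) :
    amp U l' l = (if l' = k then c else 0) + (if l' = m then d else 0) := by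
  have hb : ∀ l' k : Bits n × Bits n, ∑ p, star (bellMatrix n p l') * bellMatrix n p k =
      if l' = k then 1 else 0 := by
    intro l' k
    have := congrFun (congrFun (bellMatrix_conjTranspose_mul n) l') k
    rwa [Matrix.mul_apply, Matrix.one_apply] at this
  have hp : ∀ p, (((U : Matrix (Bits n) (Bits n) ℂ) ⊗ₖ (U : Matrix (Bits n) (Bits n) ℂ)) *
      bellMatrix n) p l = c * bellMatrix n p k + d * bellMatrix n p m := by
    intro p
    rw [kronecker_mul_bellMatrix, h]
    rfl
  rw [amp, mul_assoc, Matrix.mul_apply]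
  simp only [hp, Matrix.conjTranspose_apply, mul_add, Finset.sum_add_distrib, mul_left_comm _ c,
    mul_left_comm _ d, ← Finset.mul_sum, hb, mul_ite, mul_one, mul_zero]

/-- In the anticommuting case the two exponentials cancel; in the commuting case they combine to
angle `2θ`. The sum `u + v` makes the statement at `π / 4` uniform: either the exchange fixes `l`,
or `u = 0`. -/
theorem rotation_conj_bell {n : ℕ} {H : Matrix (Bits n) (Bits n) ℂ} {a b : Site n}
    (hH : ActsAsSwap H a b) (θ : ℝ) (l : Bits n × Bits n) :
    ∃ u v : ℂ, NormedSpace.exp ((Complex.I * (θ : ℂ)) • H) * bell l *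
      (NormedSpace.exp ((Complex.I * (θ : ℂ)) • H))ᵀ = u • bell l + v • bell (swapModes a b l) ∧
      (θ = Real.pi / 4 → u • bell l + v • bell (swapModes a b l) =
        (u + v) • bell (swapModes a b l) ∧ ‖u + v‖ = 1) := by
  have hcs : Complex.cosh (Complex.I * θ) * Complex.cosh (Complex.I * θ) -
      Complex.sinh (Complex.I * θ) * Complex.sinh (Complex.I * θ) = 1 := by
    have := Complex.cosh_sq_sub_sinh_sq (Complex.I * θ)
    rwa [sq, sq] at this
  rw [exp_smul_of_mul_self hH.mul_self, Matrix.transpose_add, Matrix.transpose_smul,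
    Matrix.transpose_smul, hH.transpose_eq, Matrix.transpose_one]
  have hc2 := Complex.cosh_two_mul (Complex.I * θ)
  have hs2 := Complex.sinh_two_mul (Complex.I * θ)
  set C := Complex.cosh (Complex.I * θ)
  set S := Complex.sinh (Complex.I * θ)
  have hexp : (C • 1 + S • H) * bell l * (C • 1 + S • H) =
      (C * C) • bell l + (C * S) • (H * bell l) + (C * S) • (bell l * H) +
        (S * S) • (H * bell l * H) := by
    simp only [add_mul, mul_add, Matrix.smul_mul, Matrix.mul_smul, one_mul, mul_one]
    module
  rw [hexp]
  by_cases h : modes l a = modes l b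
  · refine ⟨1, 0, ?_, fun _ => ?_⟩
    · rw [hH.anticomm l h, neg_mul, mul_assoc, hH.mul_self, mul_one]
      have e : (C * C) • bell l + (C * S) • -(bell l * H) + (C * S) • (bell l * H) +
          (S * S) • -bell l = (C * C - S * S) • bell l := by module
      rw [e, hcs, zero_smul, add_zero]
    · rw [swapModes_of_eq h]; simp
  · obtain ⟨c, hc, h1, h2⟩ := hH.comm l h
    refine ⟨C * C + S * S, 2 * S * C * c, ?_, ?_⟩
    · have h3 : H * bell l * H = bell l := by
        rw [h1, ← h2, mul_assoc, hH.mul_self, mul_one]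
      rw [h3, h1, h2]
      module
    · rintro rfl
      have e : 2 * (Complex.I * ((Real.pi / 4 : ℝ) : ℂ)) = (Real.pi / 2 : ℝ) * Complex.I := by
        push_cast; ring
      have z : C * C + S * S = 0 := by
        rw [← sq, ← sq, ← hc2, e, Complex.cosh_mul_I, ← Complex.ofReal_cos, Real.cos_pi_div_two]; simp
      have z' : 2 * S * C = Complex.I := by
        rw [← hs2, e, Complex.sinh_mul_I, ← Complex.ofReal_sin, Real.sin_pi_div_two]; simp
      rw [z, z']
      simp [hc]

theorem amp_gate_ne_zero {n : ℕ} {g : Uni n} (hg : g ∈ gates n) {l' l : Bits n × Bits n}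
    (h : amp g l' l ≠ 0) :
    numModes (modes l') = numModes (modes l) ∧ weight (modes l') ≤ weight (modes l) + 1 := by
  obtain ⟨H, hH, θ, hg⟩ := hg
  obtain ⟨a, b, hab, hact⟩ := actsAsSwap_of_mem_generators hH
  obtain ⟨u, v, huv, -⟩ := rotation_conj_bell hact θ l
  rw [← hg] at huv
  rw [amp_of_conj_bell huv] at h
  by_cases h1 : l' = l
  · simp [h1]
  · have h2 : l' = swapModes a b l := by
      by_contra h2
      simp [h1, h2] at h
    rw [h2, modes_swapModes]
    exact ⟨numModes_comp _ _, weight_comp_swap_le _ hab⟩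

/-- A nonzero entry of a matrix product needs a chain of nonzero entries of the factors, and each
link raises the weight by at most one. -/
theorem amp_list_prod_ne_zero {n : ℕ} {gs : List (Uni n)} (hg : ∀ g ∈ gs, g ∈ gates n)
    {l' l : Bits n × Bits n} (h : amp gs.prod l' l ≠ 0) :
    numModes (modes l') = numModes (modes l) ∧ weight (modes l') ≤ weight (modes l) + gs.length := by
  induction gs generalizing l' with
  | nil =>
    rw [List.prod_nil, amp_one, Matrix.one_apply] at h
    have : l' = l := by by_contra hne; simp [hne] at h
    simp [this]
  | cons g gs ih =>
    rw [List.prod_cons, amp_mul, Matrix.mul_apply] at h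
    obtain ⟨k, -, hk⟩ := Finset.exists_ne_zero_of_sum_ne_zero h
    have h1 := amp_gate_ne_zero (hg g List.mem_cons_self) (left_ne_zero_of_mul hk)
    have h2 := ih (fun g' h' => hg g' (List.mem_cons_of_mem _ h')) (right_ne_zero_of_mul hk)
    rw [List.length_cons]
    exact ⟨h1.1.trans h2.1, by omega⟩

theorem continuous_amp {n : ℕ} (l' l : Bits n × Bits n) : Continuous fun U : Uni n => amp U l' l := by
  have he : ∀ i j : Bits n, Continuous fun U : Uni n => (U : Matrix (Bits n) (Bits n) ℂ) i j :=
    fun i j => continuous_subtype_val.matrix_elem i j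
  simp only [amp, Matrix.mul_apply, Matrix.kroneckerMap_apply]
  exact continuous_finsetSum _ fun j _ => (continuous_finsetSum _ fun k _ =>
    continuous_const.mul ((he _ _).mul (he _ _))).mul continuous_const

/-- The unitaries that conserve the number of modes form a closed subgroup containing the gates. -/
theorem amp_group_eq_zero {n : ℕ} {U : Uni n} (hU : U ∈ group n) {l' l : Bits n × Bits n}
    (h : numModes (modes l') ≠ numModes (modes l)) : amp U l' l = 0 := by
  let K : Subgroup (Uni n) :=
    { carrier := {U | ∀ l' l : Bits n × Bits n, numModes (modes l') ≠ numModes (modes l) →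
        amp U l' l = 0}
      one_mem' := fun l' l h => by
        rw [amp_one, Matrix.one_apply_ne]
        rintro rfl; exact h rfl
      mul_mem' := fun {U V} hU hV l' l h => by
        rw [amp_mul, Matrix.mul_apply]
        refine Finset.sum_eq_zero fun k _ => ?_
        by_cases hk : numModes (modes k) = numModes (modes l)
        · rw [hU l' k (hk ▸ h), zero_mul]
        · rw [hV k l hk, mul_zero]
      inv_mem' := fun {U} hU l' l h => by
        rw [amp_inv, Matrix.conjTranspose_apply, hU l l' h.symm, star_zero] }
  have hK : IsClosed (K : Set (Uni n)) := by
    have : (K : Set (Uni n)) = ⋂ (l' : Bits n × Bits n) (l : Bits n × Bits n)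
        (_ : numModes (modes l') ≠ numModes (modes l)), {U | amp U l' l = 0} := by
      ext U; simp [K]
    rw [this]
    exact isClosed_iInter fun l' => isClosed_iInter fun l => isClosed_iInter fun _ =>
      isClosed_eq (continuous_amp l' l) continuous_const
  have hle : group n ≤ K := Subgroup.topologicalClosure_minimal _
    ((Subgroup.closure_le K).mpr fun g hg l' l h => by
      by_contra hne; exact h (amp_gate_ne_zero hg hne).1) hK
  exact hle hU l' l h

/-- For the gate with angle `π / 4`, `amp` is a permutation matrix up to phases, so multiplying by
it from the left permutes the rows. -/
theorem exists_swap_mem_group {n : ℕ} {a b : Site n} (h : b.pos = a.pos + 1) :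
    ∃ W ∈ group n, ∀ (U : Uni n) (l' l : Bits n × Bits n),
      ‖amp (W * U) l' l‖ = ‖amp U (swapModes a b l') l‖ := by
  obtain ⟨H, hH, hact⟩ := exists_generator_actsAsSwap h
  have hunit : NormedSpace.exp ((Complex.I * ((Real.pi / 4 : ℝ) : ℂ)) • H) ∈
      Matrix.unitaryGroup (Bits n) ℂ := by
    rw [Matrix.mem_unitaryGroup_iff', Matrix.star_eq_conjTranspose, ← Matrix.exp_conjTranspose,
      Matrix.conjTranspose_smul, hact.conjTranspose_eq]
    rw [← Matrix.exp_add_of_commute, ← add_smul]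
    · simp [NormedSpace.exp_zero]
    · exact (Commute.refl H).smul_left _ |>.smul_right _
  refine ⟨⟨_, hunit⟩, Subgroup.le_topologicalClosure _
    (Subgroup.subset_closure ⟨H, hH, Real.pi / 4, rfl⟩), fun U l' l => ?_⟩
  have hcol : ∀ k, ∃ c : ℂ, ‖c‖ = 1 ∧ ∀ l', amp (⟨_, hunit⟩ : Uni n) l' k =
      if l' = swapModes a b k then c else 0 := by
    intro k
    obtain ⟨u, v, huv, hs⟩ := rotation_conj_bell hact (Real.pi / 4) k
    obtain ⟨hs, hn⟩ := hs rfl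
    refine ⟨u + v, hn, fun l' => ?_⟩
    rw [amp_of_conj_bell (c := u + v) (d := 0) (k := swapModes a b k) (m := k)
      (by rw [zero_smul, add_zero, ← hs]; exact huv)]
    simp
  rw [amp_mul, Matrix.mul_apply, Finset.sum_eq_single (swapModes a b l')]
  · obtain ⟨c, hc, h⟩ := hcol (swapModes a b l')
    rw [h, if_pos (swapModes_involutive a b l').symm, norm_mul, hc, one_mul]
  · intro k _ hk
    obtain ⟨c, -, h⟩ := hcol k
    rw [h, if_neg, zero_mul]
    rintro rfl
    exact hk (swapModes_involutive a b k).symm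
  · simp

/-! ### Acceptance probabilities -/

/-- The initial Bell state, with the first `n` modes. -/
noncomputable def startLabel (n : ℕ) : Bits n × Bits n := (modesEquiv n).symm (firstModes n)

theorem modes_startLabel (n : ℕ) : modes (startLabel n) = firstModes n :=
  (modesEquiv n).apply_symm_apply _

/-- A Bell state is light if its modes are closer to the first `n` modes than to the last `n`. -/
def IsLight {n : ℕ} (l : Bits n × Bits n) : Prop := 2 * weight (modes l) + n < 2 * n ^ 2

instance {n : ℕ} : DecidablePred (IsLight (n := n)) := fun l =>
  inferInstanceAs (Decidable (2 * weight (modes l) + n < 2 * n ^ 2))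

/-- The probability that `U ⊗ U` maps the initial Bell state to a light one. -/
noncomputable def lightProb {n : ℕ} (U : Uni n) : ℝ :=
  ∑ l, if IsLight l then ‖amp U l (startLabel n)‖ ^ 2 else 0

/-- With `k` gates, every label that is reached has `2 * weight + n ≤ n ^ 2 + 2 * k < 2 * n ^ 2`. -/
theorem lightProb_of_mem_shortCircuits {n : ℕ} {U : Uni n} (hU : U ∈ shortCircuits n) :
    lightProb U = 1 := by
  obtain ⟨gs, hg, hlen, rfl⟩ := hU
  rw [lightProb, ← sum_norm_amp_sq gs.prod (startLabel n)]
  refine Finset.sum_congr rfl fun l _ => ?_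
  by_cases h : amp gs.prod l (startLabel n) = 0
  · simp [h]
  · have h1 := (amp_list_prod_ne_zero hg h).2
    have h2 := weight_firstModes n
    rw [modes_startLabel] at h1
    have h3 : 2 * gs.length < n ^ 2 := by
      have : (2 * gs.length : ℝ) < (n : ℝ) ^ 2 := by linarith
      exact_mod_cast this
    have h4 : IsLight l := show 2 * weight (modes l) + n < 2 * n ^ 2 by omega
    simp [h4]

theorem integral_haar {n : ℕ} {f : Uni n → ℝ} (hf : Continuous f) :
    ∫ U, f U ∂haar n = ∫ U : group n, f U ∂(Measure.haarMeasure
      (⊤ : TopologicalSpace.PositiveCompacts (group n))) :=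
  integral_map measurable_subtype_coe.aemeasurable hf.aestronglyMeasurable

theorem integral_lightProb_haar (n : ℕ) :
    ∫ U, lightProb U ∂haar n ≤ 1 / 2 ∧ (Even n → ∫ U, lightProb U ∂haar n < 1 / 2) := by
  have hcont : ∀ l, Continuous fun U : Uni n => ‖amp U l (startLabel n)‖ ^ 2 :=
    fun l => (continuous_amp l _).norm.pow 2
  have hint : ∀ l, Integrable (fun U : Uni n => ‖amp U l (startLabel n)‖ ^ 2) (haar n) := fun l =>
    (hcont l).integrable_of_hasCompactSupport (HasCompactSupport.of_compactSpace _)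
  set p : (Site n → Bool) → ℝ := fun t =>
    ∫ U, ‖amp U ((modesEquiv n).symm t) (startLabel n)‖ ^ 2 ∂haar n with hp
  have hlp : ∫ U, lightProb U ∂haar n = ∑ t, if 2 * weight t + n < 2 * n ^ 2 then p t else 0 := by
    unfold lightProb
    rw [integral_finsetSum, ← Equiv.sum_comp (modesEquiv n)]
    · refine Finset.sum_congr rfl fun l _ => ?_
      simp only [hp, Equiv.symm_apply_apply]
      by_cases h : IsLight l
      · rw [if_pos (show 2 * weight (modesEquiv n l) + n < 2 * n ^ 2 from h)]; simp [h]
      · rw [if_neg (show ¬ 2 * weight (modesEquiv n l) + n < 2 * n ^ 2 from h)]; simp [h]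
    · intro l _
      split_ifs
      · exact hint l
      · exact integrable_zero _ _ _
  rw [hlp]
  refine sum_light_le_half (fun t => integral_nonneg fun U => by positivity) ?_ ?_ ?_
  · simp only [hp]
    rw [Equiv.sum_comp (modesEquiv n).symm
      (fun l => ∫ U, ‖amp U l (startLabel n)‖ ^ 2 ∂haar n), ← integral_finsetSum _ fun l _ => hint l]
    simp [sum_norm_amp_sq]
  · intro t ht
    simp only [hp]
    rw [integral_haar (hcont _)]
    have : ∀ U : group n, ‖amp (U : Uni n) ((modesEquiv n).symm t) (startLabel n)‖ ^ 2 = 0 := by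
      intro U
      rw [amp_group_eq_zero U.2, norm_zero, zero_pow two_ne_zero]
      rw [modes_startLabel, numModes_firstModes]
      rwa [show modes ((modesEquiv n).symm t) = t from (modesEquiv n).apply_symm_apply t]
    simp [this]
  · intro a b hab t
    obtain ⟨W, hW, hWU⟩ := exists_swap_mem_group hab
    simp only [hp]
    -- Haar invariance: `U` is replaced by `W * U`, which undoes the exchange in the row label.
    rw [integral_haar (hcont _), integral_haar (hcont _),
      ← integral_mul_left_eq_self _ (⟨W, hW⟩ : group n)]
    refine integral_congr_ae (Filter.Eventually.of_forall fun U => ?_)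
    simp only [Subgroup.coe_mul, hWU]
    congr 3
    apply swapModes_eq_of_modes
    have e : ∀ t, modes ((modesEquiv n).symm t) = t := (modesEquiv n).apply_symm_apply
    rw [e, e]
    funext s; simp

end Matchgate

namespace Matchgate

/-! ### The moment channels on the initial Bell state -/

/-- The initial Bell state. -/
noncomputable def startState (n : ℕ) : Matrix (Bits n × Bits n) (Bits n × Bits n) ℂ :=
  bellMatrix n * Matrix.single (startLabel n) (startLabel n) 1 * (bellMatrix n)ᴴ

/-- The projection to the light Bell states. -/
noncomputable def lightProj (n : ℕ) : Matrix (Bits n × Bits n) (Bits n × Bits n) ℂ :=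
  bellMatrix n * Matrix.diagonal (fun l => if IsLight l then 1 else 0) * (bellMatrix n)ᴴ

theorem startState_apply {n : ℕ} (p q : Bits n × Bits n) :
    startState n p q = bellMatrix n p (startLabel n) * star (bellMatrix n q (startLabel n)) := by
  simp [startState, Matrix.mul_apply, Matrix.single_apply, ite_and]

theorem trace_startState (n : ℕ) : (startState n).trace = 1 := by
  rw [startState, Matrix.trace_mul_comm, ← mul_assoc, bellMatrix_conjTranspose_mul, one_mul]
  simp [Matrix.trace]

theorem isState_startState (n : ℕ) : IsState (startState n) := by
  refine ⟨?_, trace_startState n⟩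
  have : startState n = Matrix.vecMulVec (fun p => bellMatrix n p (startLabel n))
      (star fun p => bellMatrix n p (startLabel n)) := by
    ext p q
    rw [startState_apply]; rfl
  rw [this]
  exact Matrix.posSemidef_vecMulVec_self_star _

theorem lightProj_conjTranspose (n : ℕ) : (lightProj n)ᴴ = lightProj n := by
  rw [lightProj, Matrix.conjTranspose_mul, Matrix.conjTranspose_mul,
    Matrix.conjTranspose_conjTranspose, Matrix.diagonal_conjTranspose, ← mul_assoc]
  congr 3
  funext l
  simp only [Pi.star_apply]
  split_ifs <;> simp

theorem lightProj_mul_self (n : ℕ) : lightProj n * lightProj n = lightProj n := by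
  have h : ∀ B C D : Matrix (Bits n × Bits n) (Bits n × Bits n) ℂ,
      B * D * C * (B * D * C) = B * D * (C * B) * D * C := fun B C D => by simp only [mul_assoc]
  rw [lightProj, h, bellMatrix_conjTranspose_mul, mul_one, mul_assoc (bellMatrix n),
    Matrix.diagonal_mul_diagonal]
  congr 3
  funext l
  split_ifs <;> simp

theorem trace_twirl_startState_mul_lightProj {n : ℕ} (U : Uni n) :
    (twirl (startState n) U * lightProj n).trace = lightProb U := by
  have h : twirl (startState n) U * lightProj n =
      ((U : Matrix (Bits n) (Bits n) ℂ) ⊗ₖ (U : Matrix (Bits n) (Bits n) ℂ)) * bellMatrix n *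
        (Matrix.single (startLabel n) (startLabel n) 1 * (amp U)ᴴ *
          Matrix.diagonal (fun l => if IsLight l then 1 else 0) * (bellMatrix n)ᴴ) := by
    simp only [twirl, startState, lightProj, amp, Matrix.conjTranspose_mul,
      Matrix.conjTranspose_conjTranspose, mul_assoc]
  rw [h, Matrix.trace_mul_comm, mul_assoc _ (bellMatrix n)ᴴ, ← mul_assoc (bellMatrix n)ᴴ,
    Matrix.trace_mul_comm, ← mul_assoc, ← mul_assoc]
  change (amp U * _ * _ * _).trace = _
  rw [Matrix.trace, lightProb, Complex.ofReal_sum]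
  refine Finset.sum_congr rfl fun l _ => ?_
  rw [Matrix.diag_apply, Matrix.mul_diagonal]
  have : (amp U * Matrix.single (startLabel n) (startLabel n) 1 * (amp U)ᴴ :
      Matrix (Bits n × Bits n) (Bits n × Bits n) ℂ) l l =
      (‖amp U l (startLabel n)‖ : ℂ) ^ 2 := by
    rw [← Complex.mul_conj']
    simp [Matrix.mul_apply, Matrix.single_apply, ite_and]
  rw [this]
  split_ifs <;> simp

theorem trace_twirl {n : ℕ} (ρ : Matrix (Bits n × Bits n) (Bits n × Bits n) ℂ) (U : Uni n) :
    (twirl ρ U).trace = ρ.trace := by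
  have h : (U : Matrix (Bits n) (Bits n) ℂ)ᴴ * U = 1 := Matrix.mem_unitaryGroup_iff'.mp U.2
  rw [twirl, Matrix.trace_mul_comm, ← mul_assoc, Matrix.conjTranspose_kronecker,
    ← Matrix.mul_kronecker_mul, h, Matrix.one_kronecker_one, one_mul]

theorem trace_moment_mul {n : ℕ} (μ : Measure (Uni n)) [IsProbabilityMeasure μ]
    (ρ A : Matrix (Bits n × Bits n) (Bits n × Bits n) ℂ) :
    (moment μ ρ * A).trace = ∫ U, (twirl ρ U * A).trace ∂μ := by
  simp only [Matrix.trace, Matrix.diag_apply, Matrix.mul_apply]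
  rw [integral_finsetSum _ fun p _ => integrable_finsetSum _ fun q _ =>
    (integrable_twirl μ ρ p q).mul_const _]
  refine Finset.sum_congr rfl fun p _ => ?_
  rw [integral_finsetSum _ fun q _ => (integrable_twirl μ ρ p q).mul_const _]
  refine Finset.sum_congr rfl fun q _ => ?_
  rw [integral_mul_const]
  rfl

theorem trace_moment {n : ℕ} (μ : Measure (Uni n)) [IsProbabilityMeasure μ]
    (ρ : Matrix (Bits n × Bits n) (Bits n × Bits n) ℂ) : (moment μ ρ).trace = ρ.trace := by
  have := trace_moment_mul μ ρ 1
  simpa [trace_twirl] using this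

theorem trace_moment_startState_mul_lightProj {n : ℕ} (μ : Measure (Uni n))
    [IsProbabilityMeasure μ] :
    (moment μ (startState n) * lightProj n).trace = ((∫ U, lightProb U ∂μ : ℝ) : ℂ) := by
  rw [trace_moment_mul, ← integral_complex_ofReal]
  simp only [trace_twirl_startState_mul_lightProj]

theorem trace_moment_short {n : ℕ} {μ : Measure (Uni n)} [IsProbabilityMeasure μ]
    (h : ∀ᵐ U ∂μ, U ∈ shortCircuits n) :
    (moment μ (startState n) * lightProj n).trace = 1 := by
  rw [trace_moment_startState_mul_lightProj,
    integral_congr_ae (h.mono fun U hU => lightProb_of_mem_shortCircuits hU)]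
  simp

theorem trace_moment_twoDesign {n : ℕ} {ν : Measure (Uni n)} [IsProbabilityMeasure ν]
    (h : IsTwoDesign ν) :
    (moment ν (startState n) * lightProj n).trace.re ≤ 1 / 2 ∧
      (Even n → (moment ν (startState n) * lightProj n).trace.re < 1 / 2) := by
  rw [show moment ν = moment (haar n) from h, trace_moment_startState_mul_lightProj,
    Complex.ofReal_re]
  exact integral_lightProb_haar n

/-! ### The diamond norm -/

/-- Let `W` diagonalise `Mᴴ * M`. The columns of `M * W` have the singular values as norms and the
rows of `Wᴴ * V` are unit vectors, so Cauchy–Schwarz bounds each diagonal term. -/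
theorem norm_trace_mul_le_traceNorm {A : Type*} [Fintype A] [DecidableEq A] (M V : Matrix A A ℂ)
    (hV : V ∈ Matrix.unitaryGroup A ℂ) : ‖(M * V).trace‖ ≤ traceNorm M := by
  have hM := Matrix.isHermitian_conjTranspose_mul_self M
  set W : Matrix A A ℂ := (hM.eigenvectorUnitary : Matrix A A ℂ) with hW
  have hWW : W * Wᴴ = 1 := Matrix.mem_unitaryGroup_iff.mp hM.eigenvectorUnitary.2
  have hWW' : Wᴴ * W = 1 := Matrix.mem_unitaryGroup_iff'.mp hM.eigenvectorUnitary.2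
  have hVV : V * Vᴴ = 1 := Matrix.mem_unitaryGroup_iff.mp hV
  have htr : (M * V).trace = ((Wᴴ * V) * (M * W)).trace := by
    rw [Matrix.trace_mul_comm, Matrix.trace_mul_comm (Wᴴ * V),
      show M * W * (Wᴴ * V) = M * (W * Wᴴ) * V by simp only [mul_assoc], hWW, mul_one,
      Matrix.trace_mul_comm]
  rw [htr, Matrix.trace, traceNorm]
  refine (norm_sum_le _ _).trans (Finset.sum_le_sum fun i _ => ?_)
  have h1 : ∑ k, ‖(Wᴴ * V) i k‖ ^ 2 = 1 := by
    have h : (Wᴴ * V) * (Wᴴ * V)ᴴ = 1 := by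
      rw [Matrix.conjTranspose_mul, Matrix.conjTranspose_conjTranspose,
        show Wᴴ * V * (Vᴴ * W) = Wᴴ * (V * Vᴴ) * W by simp only [mul_assoc], hVV, mul_one, hWW']
    have h' := congrFun (congrFun h i) i
    rw [Matrix.mul_apply, Matrix.one_apply_eq] at h'
    simp only [Matrix.conjTranspose_apply, RCLike.star_def, Complex.mul_conj'] at h'
    exact_mod_cast h'
  have h2 : ∑ k, ‖(M * W) k i‖ ^ 2 = hM.eigenvalues i := by
    have h : (M * W)ᴴ * (M * W) = Matrix.diagonal (fun j => (hM.eigenvalues j : ℂ)) := by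
      have hs : Mᴴ * M * W = W * Matrix.diagonal (fun j => (hM.eigenvalues j : ℂ)) := by
        ext a j
        have := congrFun (hM.mulVec_eigenvectorBasis j) a
        rw [Matrix.mul_diagonal]
        simpa [Matrix.mulVec, dotProduct, Matrix.mul_apply, hW, mul_comm] using this
      rw [Matrix.conjTranspose_mul, show Wᴴ * Mᴴ * (M * W) = Wᴴ * (Mᴴ * M * W) by
        simp only [mul_assoc], hs, ← mul_assoc, hWW', one_mul]
    have h' := congrFun (congrFun h i) i
    rw [Matrix.mul_apply, Matrix.diagonal_apply_eq] at h'
    simp only [Matrix.conjTranspose_apply, RCLike.star_def, Complex.conj_mul'] at h'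
    exact_mod_cast h'
  rw [Matrix.diag_apply, Matrix.mul_apply]
  calc ‖∑ k, (Wᴴ * V) i k * (M * W) k i‖ ≤ ∑ k, ‖(Wᴴ * V) i k‖ * ‖(M * W) k i‖ :=
        (norm_sum_le _ _).trans_eq (Finset.sum_congr rfl fun k _ => norm_mul _ _)
    _ ≤ √(∑ k, ‖(Wᴴ * V) i k‖ ^ 2) * √(∑ k, ‖(M * W) k i‖ ^ 2) :=
        Real.sum_mul_le_sqrt_mul_sqrt _ _ _
    _ = √(hM.eigenvalues i) := by rw [h1, h2, Real.sqrt_one, one_mul]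

theorem norm_trace_mul_le_diamondNorm {A : Type*} [Fintype A] [DecidableEq A]
    (Φ : Matrix A A ℂ →ₗ[ℂ] Matrix A A ℂ) {ρ V : Matrix A A ℂ} (hρ : IsState ρ)
    (hV : V ∈ Matrix.unitaryGroup A ℂ) :
    ENNReal.ofReal ‖(Φ ρ * V).trace‖ ≤ diamondNorm Φ := by
  -- A one-dimensional ancilla suffices for this lower bound.
  let e : A × Fin 1 ≃ A := Equiv.prodUnique A (Fin 1)
  have hstate : IsState (ρ.submatrix e e) := by
    refine ⟨hρ.1.submatrix e, ?_⟩
    rw [← hρ.2, Matrix.trace, Matrix.trace, ← Equiv.sum_comp e]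
    rfl
  have hext : extend (Fin 1) Φ (ρ.submatrix e e) = (Φ ρ).submatrix e e := by
    ext p q
    rfl
  have hVe : V.submatrix e e ∈ Matrix.unitaryGroup (A × Fin 1) ℂ := by
    rw [Matrix.mem_unitaryGroup_iff, Matrix.star_eq_conjTranspose, Matrix.conjTranspose_submatrix,
      Matrix.submatrix_mul_equiv, ← Matrix.star_eq_conjTranspose, Matrix.mem_unitaryGroup_iff.mp hV,
      Matrix.submatrix_one_equiv]
  have htr : (Φ ρ * V).trace = ((Φ ρ).submatrix e e * V.submatrix e e).trace := by
    rw [Matrix.submatrix_mul_equiv, Matrix.trace, Matrix.trace, ← Equiv.sum_comp e]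
    rfl
  refine le_trans ?_ (le_iSup_of_le 1 (le_iSup_of_le (ρ.submatrix e e) (le_iSup_of_le hstate le_rfl)))
  rw [hext, htr]
  exact ENNReal.ofReal_le_ofReal (norm_trace_mul_le_traceNorm _ _ hVe)

theorem one_le_diamondNorm {n : ℕ} (μ ν : Measure (Uni n)) [IsProbabilityMeasure μ]
    [IsProbabilityMeasure ν] (hμ : ∀ᵐ U ∂μ, U ∈ shortCircuits n) (hν : IsTwoDesign ν) :
    1 ≤ diamondNorm (moment μ - moment ν) := by
  -- The difference of the channels is traceless on the state, so the reflection `2P - 1` doubles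
  -- the gap of `P`, giving `2 * (1 - q) ≥ 1`.
  have hV : (2 : ℂ) • lightProj n - 1 ∈ Matrix.unitaryGroup (Bits n × Bits n) ℂ := by
    rw [Matrix.mem_unitaryGroup_iff, Matrix.star_eq_conjTranspose, Matrix.conjTranspose_sub,
      Matrix.conjTranspose_smul, lightProj_conjTranspose, Matrix.conjTranspose_one]
    simp only [sub_mul, mul_sub, Matrix.smul_mul, Matrix.mul_smul, lightProj_mul_self, one_mul,
      mul_one, star_ofNat]
    module
  refine le_trans ?_ (norm_trace_mul_le_diamondNorm _ (isState_startState n) hV)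
  rw [← ENNReal.ofReal_one]
  refine ENNReal.ofReal_le_ofReal ((?_ : (1 : ℝ) ≤ _).trans (Complex.re_le_norm _))
  have h1 := trace_moment_short hμ
  have h2 := (trace_moment_twoDesign hν).1
  have h3 : ((moment μ - moment ν) (startState n) * ((2 : ℂ) • lightProj n - 1)).trace =
      2 * (1 - (moment ν (startState n) * lightProj n).trace) := by
    rw [LinearMap.sub_apply, mul_sub, sub_mul, Matrix.mul_smul, Matrix.mul_smul, mul_one,
      Matrix.trace_sub, Matrix.trace_sub, Matrix.trace_sub, Matrix.trace_smul, Matrix.trace_smul,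
      h1, trace_moment, trace_moment, smul_eq_mul, smul_eq_mul]
    ring
  rw [h3]
  simp only [Complex.mul_re, Complex.sub_re, Complex.one_re, Complex.re_ofNat, Complex.im_ofNat,
    zero_mul, sub_zero]
  linarith

end Matchgate

namespace Matchgate

/-! ### Classical circuits -/

section Circuits

variable {W : Type} [Fintype W] [DecidableEq W]

/-- The gates that permute the computational basis. -/
def QGate.IsClassical : QGate W → Prop
  | .not _ => True
  | .hadamard _ => False
  | .phaseT _ => False
  | .cnot _ _ _ => True
  | .toffoli _ _ _ _ _ _ => True

/-- The action of a classical gate on the computational basis. -/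
def QGate.act : QGate W → (W → Bool) → (W → Bool)
  | .not t, y => Function.update y t (!(y t))
  -- Default values for the two gates that `IsClassical` excludes.
  | .hadamard _, y => y
  | .phaseT _, y => y
  | .cnot c t _, y => Function.update y t (xor (y t) (y c))
  | .toffoli c d t _ _ _, y => Function.update y t (xor (y t) (y c && y d))

omit [Fintype W] in
theorem QGate.act_cnot (c t : W) (h : c ≠ t) (y : W → Bool) :
    (QGate.cnot c t h).act y = Function.update y t (xor (y t) (y c)) := rfl

omit [Fintype W] in
theorem QGate.act_toffoli (c d t : W) (hcd : c ≠ d) (hct : c ≠ t) (hdt : d ≠ t) (y : W → Bool) :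
    (QGate.toffoli c d t hcd hct hdt).act y = Function.update y t (xor (y t) (y c && y d)) := rfl

/-- The action of a classical circuit on the computational basis. -/
def run : List (QGate W) → (W → Bool) → (W → Bool)
  | [], y => y
  | g :: gs, y => run gs (g.act y)

omit [Fintype W] in
theorem run_append (gs hs : List (QGate W)) (y : W → Bool) :
    run (gs ++ hs) y = run hs (run gs y) := by
  induction gs generalizing y with
  | nil => rfl
  | cons g gs ih => exact ih _

omit [Fintype W] in
theorem QGate.act_involutive (g : QGate W) : Function.Involutive g.act := by
  intro y
  cases g with
  | not t => simp [QGate.act]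
  | hadamard t => rfl
  | phaseT t => rfl
  | cnot c t h => simp [QGate.act, h]
  | toffoli c d t hcd hct hdt => simp [QGate.act, hct, hdt]

omit [Fintype W] in
theorem run_injective (gs : List (QGate W)) : Function.Injective (run gs) := by
  induction gs with
  | nil => exact fun _ _ h => h
  | cons g gs ih => exact fun _ _ h => g.act_involutive.injective (ih h)

theorem QGate.matrix_of_isClassical {g : QGate W} (hg : g.IsClassical) (x y : W → Bool) :
    g.matrix x y = if x = g.act y then 1 else 0 := by
  cases g <;> first | rfl | exact hg.elim

theorem circuitMatrix_append (gs hs : List (QGate W)) :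
    circuitMatrix (gs ++ hs) = circuitMatrix hs * circuitMatrix gs := by
  induction gs with
  | nil => simp [circuitMatrix]
  | cons g gs ih => rw [List.cons_append, circuitMatrix, circuitMatrix, ih, mul_assoc]

theorem circuitMatrix_of_isClassical {gs : List (QGate W)} (h : ∀ g ∈ gs, g.IsClassical)
    (x y : W → Bool) : circuitMatrix gs x y = if x = run gs y then 1 else 0 := by
  induction gs generalizing y with
  | nil =>
    simp only [circuitMatrix, run, Matrix.one_apply]
    congr
  | cons g gs ih =>
    rw [circuitMatrix, Matrix.mul_apply, Finset.sum_eq_single (g.act y)]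
    · rw [ih (fun g' h' => h g' (List.mem_cons_of_mem _ h')),
        QGate.matrix_of_isClassical (h g List.mem_cons_self), if_pos rfl, mul_one]
      rfl
    · intro m _ hm
      rw [QGate.matrix_of_isClassical (h g List.mem_cons_self), if_neg hm, mul_zero]
    · simp

theorem circuitMatrix_hadamards {ws : List W} (h : ws.Nodup) (x y : W → Bool) :
    circuitMatrix (ws.map QGate.hadamard) x y = if ∀ w, w ∉ ws → x w = y w then
      (ws.map fun w => (if x w && y w then (-1 : ℂ) else 1) / (√2 : ℂ)).prod else 0 := by
  induction ws generalizing y with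
  | nil => simp [circuitMatrix, Matrix.one_apply, funext_iff]
  | cons t ws ih =>
    obtain ⟨ht, hws⟩ := List.nodup_cons.mp h
    -- The remaining gates do not touch `t`, so the only contributing intermediate state is `y` with
    -- the final value `x t` already at `t`.
    rw [List.map_cons, circuitMatrix, Matrix.mul_apply,
      Finset.sum_eq_single (Function.update y t (x t))]
    · rw [ih hws]
      have e1 : (∀ w, w ∉ ws → x w = Function.update y t (x t) w) ↔
          ∀ w, w ∉ t :: ws → x w = y w := by
        refine forall_congr' fun w => ?_
        by_cases hw : w = t
        · subst hw; simp
        · simp [hw]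
      have e2 : QGate.matrix (QGate.hadamard t) (Function.update y t (x t)) y =
          (if x t && y t then (-1 : ℂ) else 1) / (√2 : ℂ) := by
        simp only [QGate.matrix, Matrix.of_apply, Function.update_self]
        rw [if_pos fun w hw => Function.update_of_ne hw _ _]
      have e3 : (ws.map fun w => (if x w && Function.update y t (x t) w then (-1 : ℂ) else 1) /
          (√2 : ℂ)) = ws.map fun w => (if x w && y w then (-1 : ℂ) else 1) / (√2 : ℂ) := by
        refine List.map_congr_left fun w hw => ?_
        rw [Function.update_of_ne (by rintro rfl; exact ht hw)]
      simp only [e1, e2, e3, List.map_cons, List.prod_cons]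
      rw [ite_mul, zero_mul, mul_comm]
    · intro m _ hm
      rw [ih hws]
      by_cases h1 : ∀ w, w ∉ ws → x w = m w
      · have : ¬ ∀ w, w ≠ t → m w = y w := by
          intro h2
          refine hm (funext fun w => ?_)
          by_cases hw : w = t
          · subst hw; simp [h1 w ht]
          · rw [Function.update_of_ne hw, h2 w hw]
        simp only [QGate.matrix, Matrix.of_apply]
        rw [if_neg this, mul_zero]
      · rw [if_neg h1, zero_mul]
    · simp

omit [Fintype W] in
theorem run_nots {ws : List W} (h : ws.Nodup) (y : W → Bool) :
    run (ws.map QGate.not) y = fun w => if w ∈ ws then !(y w) else y w := by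
  induction ws generalizing y with
  | nil => simp [run]
  | cons t ws ih =>
    obtain ⟨ht, hws⟩ := List.nodup_cons.mp h
    rw [List.map_cons, run, ih hws]
    funext w
    by_cases hw : w = t
    · subst hw; simp [ht, QGate.act]
    · simp [hw, QGate.act]

end Circuits

/-! ### The Bell basis circuit -/

variable {n a : ℕ}

/-- Every basis state of the wires comes from basis states of the two copies and the ancilla. -/
def joinEquiv (n a : ℕ) : (Bits n × Bits n) × Bits a ≃ (Wire n a → Bool) where
  toFun := join
  invFun y := ((fun i => y (.inl (.inl i)), fun i => y (.inl (.inr i))), fun i => y (.inr i))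
  left_inv _ := rfl
  right_inv y := by
    funext w
    rcases w with (i | i) | i <;> rfl

theorem ancilla_ne {i j : ℕ} (hi : i < a) (hj : j < a) (h : i ≠ j) :
    (.inr ⟨i, hi⟩ : Wire n a) ≠ .inr ⟨j, hj⟩ :=
  fun e => h (Fin.mk.inj (Sum.inr.inj e))

theorem update_join_inr (l : Bits n × Bits n) (r : Bits a) (t : Fin a) (b : Bool) :
    Function.update (join (l, r)) (.inr t) b = join (l, Function.update r t b) := by
  rw [join, join, Sum.update_elim_inr]

/-- The Hadamard gates of the Bell basis change. -/
def hadamards (n a : ℕ) : List (QGate (Wire n a)) :=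
  ((List.finRange n).map fun i => (.inl (.inr i) : Wire n a)).map QGate.hadamard

/-- The controlled-not gates of the Bell basis change. -/
def cnots (n a : ℕ) : List (QGate (Wire n a)) :=
  (List.finRange n).map fun i => QGate.cnot (.inl (.inr i)) (.inl (.inl i)) (by simp)

theorem cnots_isClassical : ∀ g ∈ cnots n a, g.IsClassical := by
  simp [cnots, QGate.IsClassical]

theorem run_cnots (p q : Bits n) (r : Bits a) :
    run (cnots n a) (join ((p, q), r)) = join ((bxor p q, q), r) := by
  have h : ∀ (is : List (Fin n)), is.Nodup → ∀ p : Bits n,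
      run (is.map fun i => (QGate.cnot (.inl (.inr i)) (.inl (.inl i)) (by simp) :
        QGate (Wire n a))) (join ((p, q), r)) =
      join ((fun i => if i ∈ is then xor (p i) (q i) else p i, q), r) := by
    intro is his
    induction is with
    | nil => intro p; simp [run]
    | cons i is ih =>
      intro p
      obtain ⟨hi, his⟩ := List.nodup_cons.mp his
      have e : (QGate.cnot (.inl (.inr i)) (.inl (.inl i)) (by simp) : QGate (Wire n a)).act
          (join ((p, q), r)) = join ((Function.update p i (xor (p i) (q i)), q), r) := by
        rw [QGate.act, join, join, Sum.update_elim_inl, Sum.update_elim_inl]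
        rfl
      rw [List.map_cons, run, e, ih his]
      congr 3
      funext j
      by_cases hj : j = i
      · subst hj; simp [hi]
      · simp [hj]
  rw [cnots, h _ (List.nodup_finRange n)]
  simp only [List.mem_finRange, if_true]
  rfl

theorem run_cnots_involutive : Function.Involutive (run (cnots n a)) := by
  intro y
  obtain ⟨⟨⟨p, q⟩, r⟩, rfl⟩ := (joinEquiv n a).surjective y
  change run _ (run _ (join _)) = join _
  rw [run_cnots, run_cnots]
  congr 3
  funext i
  simp [bxor]

theorem hadamards_join (l l' : Bits n × Bits n) (r r' : Bits a) :
    circuitMatrix (hadamards n a) (join (l, r)) (join (l', r')) =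
      if l.1 = l'.1 ∧ r = r' then chi l.2 l'.2 else 0 := by
  rw [hadamards, circuitMatrix_hadamards
    ((List.nodup_finRange n).map fun i j h => by simpa using h)]
  have e : (∀ w, w ∉ (List.finRange n).map (fun i => (.inl (.inr i) : Wire n a)) →
      join (l, r) w = join (l', r') w) ↔ (l.1 = l'.1 ∧ r = r') := by
    constructor
    · intro h
      exact ⟨funext fun i => h (.inl (.inl i)) (by simp), funext fun i => h (.inr i) (by simp)⟩
    · rintro ⟨h1, h2⟩ ((i | i) | i) hw
      · exact congrFun h1 i
      · simp at hw
      · exact congrFun h2 i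
  simp only [e, List.map_map]
  rw [chi, ← List.ofFn_eq_map, List.prod_ofFn]
  rfl

theorem bell_eq_ite (l : Bits n × Bits n) (p q : Bits n) :
    bell l p q = if bxor p q = l.1 then chi l.2 q else 0 := by
  simp only [bell, Matrix.of_apply]
  congr 1
  refine propext ⟨fun h => ?_, fun h => ?_⟩
  · rw [h]; funext i; simp [bxor, Bool.xor_comm]
  · rw [← h]; funext i; simp [bxor, Bool.xor_comm, Bool.xor_left_comm]

theorem star_bellMatrix (p l : Bits n × Bits n) : star (bellMatrix n p l) = bellMatrix n p l := by
  simp only [bellMatrix, bell, Matrix.of_apply]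
  split_ifs
  · exact star_chi _ _
  · exact star_zero _

/-- The CNOT gates write `bxor p q`, the first part of the label, and the Hadamard gates supply
`chi`. This is the adjoint of `bellMatrix`, whose entries are real. -/
theorem bellCircuit_join (p l : Bits n × Bits n) (r r' : Bits a) :
    circuitMatrix (cnots n a ++ hadamards n a) (join (l, r')) (join (p, r)) =
      if r' = r then bellMatrix n p l else 0 := by
  rw [circuitMatrix_append, Matrix.mul_apply, Finset.sum_eq_single (run (cnots n a) (join (p, r)))]
  · rw [circuitMatrix_of_isClassical cnots_isClassical, if_pos rfl, mul_one, run_cnots,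
      hadamards_join, bellMatrix, Matrix.of_apply, bell_eq_ite, ite_and]
    by_cases h : r' = r <;> simp [h, eq_comm]
  · intro m _ hm
    rw [circuitMatrix_of_isClassical cnots_isClassical, if_neg hm, mul_zero]
  · simp

/-! ### The preparation -/

/-- The circuit that prepares the initial Bell state. -/
noncomputable def prepCircuit (n a : ℕ) : List (QGate (Wire n a)) :=
  ((Finset.univ.filter fun w => join (startLabel n, fun _ : Fin a => false) w).toList.map QGate.not) ++
    (hadamards n a ++ cnots n a)

theorem length_prepCircuit (n a : ℕ) : (prepCircuit n a).length ≤ 4 * n + a := by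
  have h := Finset.card_filter_le (Finset.univ : Finset (Wire n a))
    fun w => join (startLabel n, fun _ : Fin a => false) w
  simp only [Finset.card_univ, Fintype.card_sum, Fintype.card_fin] at h
  simp only [prepCircuit, hadamards, cnots, List.length_append, List.length_map,
    Finset.length_toList, List.length_finRange]
  omega

/-- The NOT gates write the label; the two layers of the Bell circuit in reversed order then undo
the Bell basis change. -/
theorem prepCircuit_zero (p : Bits n × Bits n) (r : Bits a) :
    circuitMatrix (prepCircuit n a) (join (p, r)) (fun _ => false) =
      if r = fun _ => false then bellMatrix n p (startLabel n) else 0 := by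
  have h0 : run ((Finset.univ.filter fun w => join (startLabel n, fun _ : Fin a => false) w).toList.map
      QGate.not) (fun _ => false) = join (startLabel n, fun _ => false) := by
    rw [run_nots (Finset.nodup_toList _)]
    funext w
    cases h : join (startLabel n, fun _ : Fin a => false) w <;> simp [h]
  have hc : ∀ g ∈ ((Finset.univ.filter fun w => join (startLabel n, fun _ : Fin a => false) w).toList.map
      QGate.not), g.IsClassical := by
    intro g hg
    obtain ⟨w, -, rfl⟩ := List.mem_map.mp hg
    trivial
  rw [prepCircuit, circuitMatrix_append, Matrix.mul_apply,
    Finset.sum_eq_single (join (startLabel n, fun _ => false))]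
  · rw [circuitMatrix_of_isClassical hc, h0, if_pos rfl, mul_one, circuitMatrix_append,
      Matrix.mul_apply, Finset.sum_eq_single (run (cnots n a) (join (p, r)))]
    · rw [circuitMatrix_of_isClassical cnots_isClassical, run_cnots_involutive, if_pos rfl, one_mul,
        run_cnots, hadamards_join, bellMatrix, Matrix.of_apply, bell_eq_ite, chi_comm, ite_and]
      split_ifs <;> rfl
    · intro m _ hm
      rw [circuitMatrix_of_isClassical cnots_isClassical, if_neg, zero_mul]
      intro h
      exact hm (by rw [h, run_cnots_involutive])
    · simp
  · intro m _ hm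
    rw [circuitMatrix_of_isClassical hc, h0, if_neg hm, mul_zero]
  · simp

/-! ### The classical part of the measurement -/

/-- There is a classical circuit with at most `k` gates that maps `S i` to `S' i` for every `i`. -/
def Implements {ι : Type*} {W : Type} [DecidableEq W] (k : ℕ) (S S' : ι → W → Bool) : Prop :=
  ∃ gs : List (QGate W), (∀ g ∈ gs, g.IsClassical) ∧ gs.length ≤ k ∧ ∀ i, run gs (S i) = S' i

section Implements

variable {ι : Type*} {W : Type} [DecidableEq W]

theorem Implements.refl (S : ι → W → Bool) : Implements 0 S S :=
  ⟨[], by simp, le_rfl, fun _ => rfl⟩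

theorem Implements.trans {k k' : ℕ} {S S' S'' : ι → W → Bool} (h : Implements k S S')
    (h' : Implements k' S' S'') : Implements (k + k') S S'' := by
  obtain ⟨gs, hc, hl, hr⟩ := h
  obtain ⟨gs', hc', hl', hr'⟩ := h'
  refine ⟨gs ++ gs', fun g hg => ?_, ?_, fun i => by rw [run_append, hr, hr']⟩
  · rcases List.mem_append.mp hg with hg | hg
    exacts [hc g hg, hc' g hg]
  · rw [List.length_append]; omega

theorem Implements.mono {k k' : ℕ} {S S' : ι → W → Bool} (h : Implements k S S') (hk : k ≤ k') :
    Implements k' S S' := by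
  obtain ⟨gs, hc, hl, hr⟩ := h
  exact ⟨gs, hc, hl.trans hk, hr⟩

theorem Implements.of_gate {S S' : ι → W → Bool} (g : QGate W) (hg : g.IsClassical)
    (h : ∀ i, g.act (S i) = S' i) : Implements 1 S S' :=
  ⟨[g], by simpa using hg, le_rfl, h⟩

end Implements

/-- The ancilla register: a control bit, an output bit, and the parities of the binomial
coefficients of a counter. -/
def reg (M : ℕ) (c o : Bool) (w : ℕ) : Bits (M + 3) := fun j =>
  if (j : ℕ) = 0 then c else if (j : ℕ) = 1 then o else decide (Odd (w.choose (j - 2)))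

variable {M : ℕ} {c : Bits n × Bits n → Bool} {o : Bits n × Bits n → Bool} {w : Bits n × Bits n → ℕ}

/-- A counter at 0 is not the zero register: the wire 2 holds the parity of `0.choose 0 = 1`. -/
theorem implements_start : Implements 1 (fun l : Bits n × Bits n => join (l, fun _ : Fin (M + 3) => false))
    (fun l => join (l, reg M false false 0)) := by
  refine Implements.of_gate (.not (.inr ⟨2, by omega⟩)) trivial fun l => ?_
  rw [QGate.act, update_join_inr]
  congr 2
  funext j
  rw [Function.update_apply, reg]
  obtain ⟨j, hj⟩ := j
  simp only [Fin.mk.injEq]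
  match j with
  | 0 => simp
  | 1 => simp
  | 2 => simp [join]
  | j + 3 => simp

theorem implements_cnot_control (b : Fin n ⊕ Fin n) :
    Implements 1 (fun l => join (l, reg M (c l) (o l) (w l)))
      (fun l => join (l, reg M (xor (c l) (join (l, reg M (c l) (o l) (w l)) (.inl b))) (o l) (w l))) := by
  refine Implements.of_gate (.cnot (.inl b) (.inr ⟨0, by omega⟩) Sum.inl_ne_inr) trivial fun l => ?_
  rw [QGate.act_cnot, update_join_inr]
  congr 2
  funext j
  rw [Function.update_apply]
  by_cases hj : (j : ℕ) = 0
  · rw [if_pos (Fin.ext hj)]; simp [reg, hj, join]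
  · rw [if_neg (fun h => hj (by rw [h]))]; simp [reg, hj]

theorem implements_not_control :
    Implements 1 (fun l => join (l, reg M (c l) (o l) (w l)))
      (fun l => join (l, reg M (!(c l)) (o l) (w l))) := by
  refine Implements.of_gate (.not (.inr ⟨0, by omega⟩)) trivial fun l => ?_
  rw [QGate.act, update_join_inr]
  congr 2
  funext j
  rw [Function.update_apply]
  by_cases hj : (j : ℕ) = 0
  · rw [if_pos (Fin.ext hj)]; simp [reg, join, hj]
  · rw [if_neg (fun h => hj (by rw [h]))]; simp [reg, hj]

theorem exists_pascal_circuit {m : ℕ} (hm : m ≤ M) :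
    ∃ gs : List (QGate (Wire n (M + 3))), (∀ g ∈ gs, g.IsClassical) ∧ gs.length ≤ m ∧
      ∀ (l : Bits n × Bits n) (r : Bits (M + 3)), run gs (join (l, r)) = join (l, fun j =>
        if 3 ≤ (j : ℕ) ∧ (j : ℕ) ≤ m + 2 then
          xor (r j) (r ⟨0, by omega⟩ && r ⟨(j : ℕ) - 1, by omega⟩) else r j) := by
  induction m with
  | zero =>
    refine ⟨[], by simp, le_rfl, fun l r => ?_⟩
    rw [run]
    congr 2
    funext j
    rw [if_neg (by omega)]
  | succ m ih =>
    obtain ⟨gs, hc, hl, hr⟩ := ih (by omega)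
    -- The highest wire is updated first, so that each gate reads the old value of its lower
    -- neighbour.
    refine ⟨.toffoli (.inr ⟨0, by omega⟩) (.inr ⟨m + 2, by omega⟩) (.inr ⟨m + 3, by omega⟩)
      (ancilla_ne _ _ (by omega)) (ancilla_ne _ _ (by omega)) (ancilla_ne _ _ (by omega)) :: gs, ?_, ?_, fun l r => ?_⟩
    · intro g hg
      rcases List.mem_cons.mp hg with rfl | hg
      exacts [trivial, hc g hg]
    · rw [List.length_cons]; omega
    · rw [run, QGate.act_toffoli, update_join_inr, hr]
      congr 2
      funext j
      obtain ⟨j, hj⟩ := j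
      simp only [Function.update_apply, Fin.mk.injEq]
      by_cases h1 : j = m + 3
      · subst h1
        rw [if_neg (by omega), if_pos rfl, if_pos (by omega)]
        rfl
      · rw [if_neg h1]
        by_cases h2 : 3 ≤ j ∧ j ≤ m + 2
        · rw [if_pos h2, if_neg (show ¬ 0 = m + 3 by omega), if_neg (show ¬ j - 1 = m + 3 by omega),
            if_pos (show 3 ≤ j ∧ j ≤ m + 1 + 2 by omega)]
        · rw [if_neg h2, if_neg (by omega)]

/-- Pascal's rule modulo 2: adding 1 to `w` adds to each binomial parity its lower neighbour. In
this encoding a controlled increment needs no carries and no scratch space. -/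
theorem implements_increment :
    Implements M (fun l => join (l, reg M (c l) (o l) (w l)))
      (fun l => join (l, reg M (c l) (o l) (w l + (c l).toNat))) := by
  obtain ⟨gs, hc, hl, hr⟩ := exists_pascal_circuit (n := n) (le_refl M)
  refine ⟨gs, hc, hl, fun l => ?_⟩
  rw [hr]
  congr 2
  funext j
  obtain ⟨j, hj⟩ := j
  match j with
  | 0 => simp [reg]
  | 1 => simp [reg]
  | 2 => simp [reg]
  | j + 3 =>
    rw [if_pos ⟨by simp, by simpa using hj⟩]
    cases h : c l
    · simp [reg]
    · simp [reg, Nat.choose_succ_succ, Nat.odd_add]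
      by_cases h1 : Odd ((w l).choose j) <;> by_cases h2 : Odd ((w l).choose (j + 1)) <;>
        simp [h1, h2, ← Nat.not_odd_iff_even]

theorem implements_add (k : ℕ) :
    Implements (k * M) (fun l => join (l, reg M (c l) (o l) (w l)))
      (fun l => join (l, reg M (c l) (o l) (w l + (c l).toNat * k))) := by
  induction k with
  | zero => simpa using Implements.refl _
  | succ k ih =>
    have := ih.trans implements_increment
    rw [Nat.succ_mul]
    simpa [mul_add, add_assoc] using this

/-- The binomial parities are triangular: `k.choose m` vanishes for `k < m` and is 1 for `k = m`. So
one optional CNOT corrects the value at `m` and keeps all earlier ones. -/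
theorem implements_output (f : ℕ → Bool) (m : ℕ) (hm : m ≤ M + 1) :
    ∃ F : ℕ → Bool, (∀ k < m, F k = f k) ∧
      Implements m (fun l => join (l, reg M (c l) false (w l)))
        (fun l => join (l, reg M (c l) (F (w l)) (w l))) := by
  induction m with
  | zero => exact ⟨fun _ => false, by simp, Implements.refl _⟩
  | succ m ih =>
    obtain ⟨F, hF, hi⟩ := ih (by omega)
    by_cases h : F m = f m
    · refine ⟨F, fun k hk => ?_, hi.mono (by omega)⟩
      rcases Nat.lt_succ_iff_lt_or_eq.mp hk with hk | rfl
      exacts [hF k hk, h]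
    · refine ⟨fun k => xor (F k) (decide (Odd (k.choose m))), fun k hk => ?_, hi.trans ?_⟩
      · rcases Nat.lt_succ_iff_lt_or_eq.mp hk with hk | rfl
        · simp [Nat.choose_eq_zero_of_lt hk, hF k hk]
        · revert h
          simp only [Nat.choose_self, odd_one, decide_true]
          cases F k <;> cases f k <;> simp
      · refine Implements.of_gate (.cnot (.inr ⟨m + 2, by omega⟩) (.inr ⟨1, by omega⟩)
          (ancilla_ne _ _ (by omega))) trivial fun l => ?_
        rw [QGate.act_cnot, update_join_inr]
        congr 2
        funext j
        rw [Function.update_apply]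
        by_cases hj : (j : ℕ) = 1
        · rw [if_pos (Fin.ext hj)]; simp [reg, hj, join]
        · rw [if_neg (fun h => hj (by rw [h]))]; simp [reg, hj]

/-! ### Computing the weight with the counter. -/

/-- The part of the weight of a set of modes that belongs to the first `k` qubits. -/
def partialWeight (l : Bits n × Bits n) (k : ℕ) : ℕ :=
  ∑ i : Fin n, if (i : ℕ) < k then (modes l (i, false)).toNat * (2 * i) +
    (modes l (i, true)).toNat * (2 * i + 1) else 0

theorem partialWeight_succ (l : Bits n × Bits n) (i : Fin n) : partialWeight l (i + 1) =
    partialWeight l i + (modes l (i, false)).toNat * (2 * i) +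
      (modes l (i, true)).toNat * (2 * i + 1) := by
  have h : ∀ j : Fin n, (if (j : ℕ) < i + 1 then (modes l (j, false)).toNat * (2 * j) +
      (modes l (j, true)).toNat * (2 * j + 1) else 0) =
      (if (j : ℕ) < i then (modes l (j, false)).toNat * (2 * j) +
      (modes l (j, true)).toNat * (2 * j + 1) else 0) + if j = i then
        (modes l (j, false)).toNat * (2 * j) + (modes l (j, true)).toNat * (2 * j + 1) else 0 := by
    intro j
    rcases lt_trichotomy (j : ℕ) i with h | h | h
    · rw [if_pos (by omega), if_pos h, if_neg (fun e => by rw [e] at h; omega), add_zero]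
    · rw [if_pos (by omega), if_neg (by omega), if_pos (Fin.ext h), zero_add]
    · rw [if_neg (by omega), if_neg (by omega), if_neg (fun e => by rw [e] at h; omega)]
  rw [partialWeight, Finset.sum_congr rfl fun j _ => h j, Finset.sum_add_distrib,
    Finset.sum_ite_eq' Finset.univ i, if_pos (Finset.mem_univ i), add_assoc]
  rfl

theorem partialWeight_self (l : Bits n × Bits n) : partialWeight l n = weight (modes l) := by
  rw [partialWeight, weight, Fintype.sum_prod_type]
  refine Finset.sum_congr rfl fun i _ => ?_
  rw [if_pos i.2, Fintype.sum_bool, add_comm]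
  simp [Site.pos]

/-- The control bit passes from the prefix parity of length `k` through the two modes of qubit `k`
to the prefix parity of length `k + 1`. This takes five single gates, and each mode controls the
addition of its position while it is present. -/
theorem implements_partialWeight (k : ℕ) (hk : k ≤ n) :
    Implements (k * (4 * n * M + 5)) (fun l : Bits n × Bits n => join (l, reg M false false 0))
      (fun l => join (l, reg M (prefixParity l.1 k) false (partialWeight l k))) := by
  induction k with
  | zero => simpa [partialWeight, prefixParity] using Implements.refl _
  | succ k ih =>
    set i : Fin n := ⟨k, hk⟩
    have h1 := implements_cnot_control (M := M) (c := fun l => prefixParity l.1 k)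
      (o := fun _ => false) (w := fun l => partialWeight l k) (.inr i)
    have e1 : ∀ l : Bits n × Bits n, xor (prefixParity l.1 k) (l.2 i) = modes l (i, false) :=
      fun l => by rw [modes_false, Bool.xor_comm]
    have h2 := implements_add (M := M) (c := fun l => modes l (i, false))
      (o := fun _ => false) (w := fun l => partialWeight l k) (2 * k)
    have h3 := implements_cnot_control (M := M) (c := fun l => modes l (i, false))
      (o := fun _ => false) (w := fun l => partialWeight l k + (modes l (i, false)).toNat * (2 * k))
      (.inl i)
    have h4 := implements_not_control (M := M) (c := fun l => xor (modes l (i, false)) (l.1 i))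
      (o := fun _ => false) (w := fun l => partialWeight l k + (modes l (i, false)).toNat * (2 * k))
    have e2 : ∀ l : Bits n × Bits n, (!(xor (modes l (i, false)) (l.1 i))) = modes l (i, true) :=
      fun l => by rw [modes_false, modes_true, Bool.xor_assoc]
    have h5 := implements_add (M := M) (c := fun l => modes l (i, true))
      (o := fun _ => false) (w := fun l => partialWeight l k + (modes l (i, false)).toNat * (2 * k))
      (2 * k + 1)
    have e3 : ∀ l : Bits n × Bits n, partialWeight l k + (modes l (i, false)).toNat * (2 * k) +
        (modes l (i, true)).toNat * (2 * k + 1) = partialWeight l (k + 1) :=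
      fun l => (partialWeight_succ l i).symm
    have h6 := implements_cnot_control (M := M) (c := fun l => modes l (i, true))
      (o := fun _ => false) (w := fun l => partialWeight l (k + 1)) (.inr i)
    have h7 := implements_not_control (M := M) (c := fun l => xor (modes l (i, true)) (l.2 i))
      (o := fun _ => false) (w := fun l => partialWeight l (k + 1))
    have e4 : ∀ l : Bits n × Bits n, (!(xor (modes l (i, true)) (l.2 i))) =
        prefixParity l.1 (k + 1) := fun l => by
      rw [modes_true, ← prefixParity_succ l.1 i]
      change (!(xor (!(xor _ (prefixParity l.1 (k + 1)))) _)) = _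
      cases l.2 i <;> simp
    simp only [join, Sum.elim_inl, Sum.elim_inr, e1, e2, e3, e4] at ih h1 h2 h3 h4 h5 h6 h7 ⊢
    refine ((ih (by omega)).trans (h1.trans (h2.trans (h3.trans (h4.trans (h5.trans
      (h6.trans h7))))))).mono ?_
    have : (2 * k * M) + (2 * k + 1) * M ≤ 4 * n * M := by
      rw [← add_mul]; exact Nat.mul_le_mul_right _ (by omega)
    rw [show (k + 1) * (4 * n * M + 5) = k * (4 * n * M + 5) + (4 * n * M + 5) by ring]
    omega

theorem weight_le (t : Site n → Bool) : weight t ≤ 4 * n ^ 2 := by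
  have h := weight_comp_reflect t
  have h' : numModes t ≤ 2 * n := by
    calc numModes t ≤ ∑ _s : Site n, 1 := Finset.sum_le_sum fun s _ => Bool.toNat_le _
      _ = 2 * n := by simp [mul_comm]
  have := Nat.mul_le_mul_right (2 * n) h'
  nlinarith

theorem exists_classical_circuit (n : ℕ) :
    ∃ gs : List (QGate (Wire n (4 * n ^ 2 + 3))), (∀ g ∈ gs, g.IsClassical) ∧
      gs.length ≤ 1 + n * (4 * n * (4 * n ^ 2) + 5) + (4 * n ^ 2 + 1) ∧
      ∀ l : Bits n × Bits n, run gs (join (l, fun _ => false)) (.inr ⟨1, by omega⟩) =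
        decide (IsLight l) := by
  obtain ⟨F, hF, hi⟩ := implements_output (M := 4 * n ^ 2) (c := fun l => prefixParity l.1 n)
    (w := fun l => partialWeight l n) (fun k => decide (2 * k + n < 2 * n ^ 2)) _ le_rfl
  obtain ⟨gs, hc, hl, hr⟩ := (implements_start.trans (implements_partialWeight n le_rfl)).trans hi
  refine ⟨gs, hc, hl, fun l => ?_⟩
  simp only [hr]
  rw [hF _ (by rw [partialWeight_self]; exact Nat.lt_succ_of_le (weight_le _)),
    partialWeight_self]
  simp only [join, reg, Sum.elim_inr, one_ne_zero, if_false, if_true]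
  rfl

end Matchgate

namespace Matchgate

variable {n a : ℕ}

/-! ### The experiment -/

theorem experiment_state {E : Experiment n a} (h : E.prep = prepCircuit n a)
    (p q : (Bits n × Bits n) × Bits a) : E.state p q =
      if p.2 = (fun _ => false) ∧ q.2 = (fun _ => false) then startState n p.1 q.1 else 0 := by
  obtain ⟨p, r⟩ := p
  obtain ⟨q, s⟩ := q
  have hs : E.state (p, r) (q, s) = circuitMatrix E.prep (join (p, r)) (fun _ => false) *
      star (circuitMatrix E.prep (join (q, s)) (fun _ => false)) := by
    rw [Experiment.state, Matrix.submatrix_apply, Matrix.mul_apply, Finset.sum_eq_single (fun _ => false)]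
    · rw [Matrix.mul_apply, Finset.sum_eq_single (fun _ => false)]
      · simp
      · intro b _ hb
        rw [Matrix.single_apply_of_row_ne (Ne.symm hb), mul_zero]
      · simp
    · intro b _ hb
      rw [Matrix.mul_apply, Finset.sum_eq_zero, zero_mul]
      intro c _
      rw [Matrix.single_apply_of_col_ne _ _ (Ne.symm hb), mul_zero]
    · simp
  rw [hs, h, prepCircuit_zero, prepCircuit_zero, startState_apply]
  by_cases h1 : r = fun _ => false <;> by_cases h2 : s = fun _ => false <;> simp [h1, h2]

/-- A permutation of the basis keeps a diagonal effect diagonal, so the values left behind on the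
other ancilla wires need not be erased. -/
theorem circuitMatrix_conj_diagonal {W : Type} [Fintype W] [DecidableEq W] {gs : List (QGate W)}
    (h : ∀ g ∈ gs, g.IsClassical) (d : (W → Bool) → ℂ) :
    (circuitMatrix gs)ᴴ * Matrix.diagonal d * circuitMatrix gs =
      Matrix.diagonal fun x => d (run gs x) := by
  ext x y
  rw [Matrix.mul_apply, Finset.sum_eq_single (run gs y)]
  · rw [Matrix.mul_diagonal, Matrix.conjTranspose_apply, circuitMatrix_of_isClassical h,
      circuitMatrix_of_isClassical h, if_pos rfl, mul_one, Matrix.diagonal_apply]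
    by_cases hxy : x = y
    · simp [hxy]
    · rw [if_neg fun e => hxy (run_injective gs e.symm), if_neg hxy, star_zero, zero_mul]
  · intro z _ hz
    rw [circuitMatrix_of_isClassical h, if_neg hz, mul_zero]
  · simp

theorem experiment_effect {E : Experiment n a} {gs : List (QGate (Wire n a))}
    (h : E.post = (cnots n a ++ hadamards n a) ++ gs) (hgs : ∀ g ∈ gs, g.IsClassical)
    (hout : ∀ l : Bits n × Bits n, run gs (join (l, fun _ => false)) E.out = decide (IsLight l))
    (p q : Bits n × Bits n) :
    E.effect (p, fun _ => false) (q, fun _ => false) = lightProj n p q := by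
  have h1 : E.effect (p, fun _ => false) (q, fun _ => false) =
      ((circuitMatrix (cnots n a ++ hadamards n a))ᴴ *
        Matrix.diagonal (fun x : Wire n a → Bool => if run gs x E.out then (1 : ℂ) else 0) *
        circuitMatrix (cnots n a ++ hadamards n a)) (join (p, fun _ => false))
          (join (q, fun _ => false)) := by
    rw [Experiment.effect, Matrix.submatrix_apply, h, circuitMatrix_append,
      ← circuitMatrix_conj_diagonal hgs (fun x => if x E.out then (1 : ℂ) else 0),
      Matrix.conjTranspose_mul]
    simp only [mul_assoc]
  rw [h1, Matrix.mul_apply, ← Equiv.sum_comp (joinEquiv n a), Fintype.sum_prod_type, lightProj,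
    Matrix.mul_apply]
  refine Finset.sum_congr rfl fun l _ => ?_
  rw [Finset.sum_eq_single (fun _ => false)]
  · change _ * circuitMatrix _ (join (l, _)) _ = _
    rw [bellCircuit_join, if_pos rfl, Matrix.mul_diagonal, Matrix.mul_diagonal,
      Matrix.conjTranspose_apply, Matrix.conjTranspose_apply]
    change star (circuitMatrix _ (join (l, _)) _) * (if run gs (join (l, _)) _ then _ else _) * _ = _
    rw [bellCircuit_join, if_pos rfl, star_bellMatrix, star_bellMatrix, hout]
    simp
  · intro r _ hr
    change _ * circuitMatrix _ (join (l, r)) _ = _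
    rw [bellCircuit_join, if_neg hr, mul_zero]
  · simp

/-- The prepared ancilla is in the zero state and `Φ` leaves it alone, so only the zero block of `P`
matters. -/
theorem trace_extend_mul {E : Experiment n a} (h : E.prep = prepCircuit n a)
    (Φ : Matrix (Bits n × Bits n) (Bits n × Bits n) ℂ →ₗ[ℂ]
      Matrix (Bits n × Bits n) (Bits n × Bits n) ℂ)
    {P : Matrix ((Bits n × Bits n) × Bits a) ((Bits n × Bits n) × Bits a) ℂ}
    {A : Matrix (Bits n × Bits n) (Bits n × Bits n) ℂ}
    (hP : ∀ p q, P (p, fun _ => false) (q, fun _ => false) = A p q) :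
    (extend (Bits a) Φ E.state * P).trace = (Φ (startState n) * A).trace := by
  have he : ∀ p q : (Bits n × Bits n) × Bits a, extend (Bits a) Φ E.state p q =
      if p.2 = (fun _ => false) ∧ q.2 = (fun _ => false) then Φ (startState n) p.1 q.1 else 0 := by
    intro p q
    rw [extend, Matrix.of_apply]
    simp only [experiment_state h]
    by_cases hpq : p.2 = (fun _ => false) ∧ q.2 = (fun _ => false)
    · simp only [hpq, and_self, if_true]
      rfl
    · simp only [hpq, if_false]
      change Φ 0 _ _ = _
      rw [map_zero]
      rfl
  simp only [Matrix.trace, Matrix.diag_apply, Matrix.mul_apply, he]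
  rw [Fintype.sum_prod_type]
  refine Finset.sum_congr rfl fun p _ => ?_
  rw [Finset.sum_eq_single (fun _ => false)]
  · rw [Fintype.sum_prod_type]
    refine Finset.sum_congr rfl fun q _ => ?_
    rw [Finset.sum_eq_single (fun _ => false)]
    · simp [hP]
    · intro r _ hr
      simp [hr]
    · simp
  · intro r _ hr
    simp [hr]
  · simp

theorem successProb_experiment {E : Experiment n a} (h : E.prep = prepCircuit n a)
    (hE : ∀ p q, E.effect (p, fun _ => false) (q, fun _ => false) = lightProj n p q)
    {μ ν : Measure (Uni n)} [IsProbabilityMeasure μ] [IsProbabilityMeasure ν]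
    (hμ : ∀ᵐ U ∂μ, U ∈ shortCircuits n) (hν : IsTwoDesign ν) :
    3 / 4 ≤ successProb μ ν E.state E.effect ∧
      (Even n → 3 / 4 < successProb μ ν E.state E.effect) := by
  have h1 : ∀ p q : Bits n × Bits n, (1 - E.effect) (p, fun _ => false) (q, fun _ => false) =
      (1 - lightProj n) p q := by
    intro p q
    rw [Matrix.sub_apply, Matrix.sub_apply, hE, Matrix.one_apply, Matrix.one_apply]
    simp
  have hs : successProb μ ν E.state E.effect =
      1 - 1 / 2 * (moment ν (startState n) * lightProj n).trace.re := by
    rw [successProb, trace_extend_mul h _ hE, trace_extend_mul h _ h1, trace_moment_short hμ, mul_sub,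
      mul_one, Matrix.trace_sub, trace_moment, trace_startState, Complex.sub_re, Complex.one_re]
    ring
  obtain ⟨h2, h3⟩ := trace_moment_twoDesign hν
  rw [hs]
  exact ⟨by linarith, fun he => by linarith [h3 he]⟩

end Matchgate

/-- Ensembles of matchgate circuits with fewer than `n ^ 2 / 2` gates have diamond distance at least
`1` from every matchgate 2-design, and there are experiments of polynomial size, which depend on `n`
only, that distinguish them with success probability at least `3 / 4` (more, if `n` is even). -/
theorem corollary7 :
    (∀ (n : ℕ) (μ ν : Measure (Uni n)) [IsProbabilityMeasure μ] [IsProbabilityMeasure ν],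
      (∀ᵐ U ∂μ, U ∈ shortCircuits n) → IsTwoDesign ν →
        1 ≤ diamondNorm (moment μ - moment ν)) ∧
    ∃ p : Polynomial ℕ, ∀ n : ℕ, ∃ (a : ℕ) (E : Experiment n a), E.size ≤ p.eval n ∧
      ∀ (μ ν : Measure (Uni n)) [IsProbabilityMeasure μ] [IsProbabilityMeasure ν],
        (∀ᵐ U ∂μ, U ∈ shortCircuits n) → IsTwoDesign ν →
          3 / 4 ≤ successProb μ ν E.state E.effect ∧
          (Even n → 3 / 4 < successProb μ ν E.state E.effect) := by
  refine ⟨fun n μ ν _ _ hμ hν => one_le_diamondNorm μ ν hμ hν,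
    -- The summands bound the preparation, the final circuit and the ancilla. The number `4 * n ^ 2
    -- + 3` of ancilla qubits comes from `weight_le`, plus the control, the output and the constant
    -- `w.choose 0`.
    (4 * .X + (4 * .X ^ 2 + 3)) + (2 * .X + (1 + .X * (4 * .X * (4 * .X ^ 2) + 5) + (4 * .X ^ 2 + 1))) +
      (4 * .X ^ 2 + 3), fun n => ?_⟩
  obtain ⟨gs, hc, hl, hr⟩ := exists_classical_circuit n
  let E : Experiment n (4 * n ^ 2 + 3) :=
    { prep := prepCircuit n (4 * n ^ 2 + 3)
      post := (cnots n (4 * n ^ 2 + 3) ++ hadamards n (4 * n ^ 2 + 3)) ++ gs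
      out := .inr ⟨1, by omega⟩ }
  refine ⟨4 * n ^ 2 + 3, E, ?_, fun μ ν _ _ hμ hν =>
    successProb_experiment rfl (experiment_effect rfl hc hr) hμ hν⟩
  have h1 := length_prepCircuit n (4 * n ^ 2 + 3)
  have h2 : E.post.length = 2 * n + gs.length := by
    simp only [E, List.length_append, cnots, hadamards, List.length_map, List.length_finRange]
    omega
  simp only [Polynomial.eval_add, Polynomial.eval_mul, Polynomial.eval_pow, Polynomial.eval_X,
    Polynomial.eval_ofNat, Polynomial.eval_one]
  rw [Experiment.size, h2]
  exact Nat.add_le_add (Nat.add_le_add h1 (Nat.add_le_add_left hl _)) le_rfl
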